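/- **Setting.** Minkowski space is $\mathbb R^4$ with coordinates $(t,x,y,z)$ and metric $\eta=\mathrm{diag}(1,-1,-1,-1)$; $V_+=\{v: v^0>0,\ v\cdot v>0\}$. Let $P_+$ be the proper Poincaré group, i.e. the pairs $g=(a,\Lambda)$, acting by $v\mapsto \Lambda v+a$, with $\Lambda^{T}\eta\Lambda=\eta$ and $\det\Lambda=1$. Let $U$ be a positive-energy representation of $P_+$ on a complex Hilbert space $H$ (for instance a Wigner one-particle representation of integer spin or helicity, doubled if particle and antiparticle differ): $U$ is strongly continuous, $U(g)$ is unitary if $g$ preserves the direction of time ($\Lambda_{00}>0$) and antiunitary if $g$ reverses it ($\Lambda_{00}<0$), and for every $a\in\overline{V_+}$ the generator $a\cdot P$ of $\tau\mapsto U(\tau a,1)=e^{i\tau\, a\cdot P}$ is a positive operator. Let $W_{\rm st}=\{x>|t|\}$ be the standard wedge, $\Lambda(\chi)$ the boost $t\mapsto t\cosh\chi-x\sinh\chi$, $x\mapsto x\cosh\chi-t\sinh\chi$, and $r$ the reflection $(t,x,y,z)\mapsto(-t,-x,y,z)$. Put $\delta^{i\tau}=U(\Lambda(2\pi\tau))$,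 $j=U(r)$, $s=j\delta^{1/2}$, where $\delta^{1/2}$ is formed by functional calculus, and let $H_R=\{\psi\in\mathrm{dom}(s): s\psi=-\psi\}$. For a wedge $W=gW_{\rm st}$, $g\in P_+$, put $H_R(W)=U(g)H_R$. For a double cone $O=(p+V_+)\cap(q-V_+)$, $q-p\in V_+$, put $$H_R(O)=\bigcap_{W\supset O}H_R(W),$$ the intersection running over all wedges containing $O$. Let $O'$ be the causal complement of $O$, i.e. the set of all points spacelike to every point of $O$, and let $H_R(O')$ be the closed real subspace generated by the $H_R(W)$ of all wedges $W\subset O'$. For a real subspace $K$ let $K^\perp$ and $K'$ be its complements with respect to $\mathrm{Re}(\psi,\varphi)$ and $\mathrm{Im}(\psi,\varphi)$. **Theorem.** The spaces $H_R(W)$ are well defined (they depend only on $W$, not on the choice of $g$) and closed. The spaces $H_R(O)$ and $H_R(O')$, $O$ a double cone, form an orthocomplemented net of closed real subspaces of $H$: all of them are closed real subspaces; for double cones $O_1,O_2$ one has $H_R(O_1)\subset H_R(O_2)$ if $O_1\subset O_2$, $H_R(O_1')\subset H_R(O_2')$ if $O_1'\subset O_2'$, and $H_R(O_1)\subset H_R(O_2')$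 if $O_1\subset O_2'$; and for every double cone $O$ $$H_R(O')=H_R(O)'=i\,H_R(O)^{\perp},\qquad H_R(O)=H_R(O')'.$$ -/

import Mathlib

open MeasureTheory ComplexConjugate
open scoped FourierTransform ContDiff InnerProductSpace Matrix

noncomputable section

namespace ModLoc

/-! ### Minkowski space and the proper Poincaré group -/

/-- Points (and vectors) of four-dimensional Minkowski space, coordinates `(t, x, y, z)`. -/
abbrev Mink : Type := Fin 4 → ℝ

/-- The Minkowski metric, signature `(+,-,-,-)`. -/
def eta : Matrix (Fin 4) (Fin 4) ℝ := Matrix.diagonal ![1, -1, -1, -1]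

/-- The Minkowski square `v·v` of a vector. -/
def msq (v : Mink) : ℝ := v ⬝ᵥ (eta *ᵥ v)

/-- The open forward light cone. -/
def forwardCone : Set Mink := {v | 0 < v 0 ∧ 0 < msq v}

/-- The proper Poincaré group `P₊`: pairs `(a, Λ)` of a translation and a Lorentz matrix of
determinant one.  It has two components: the transformations with `Λ 0 0 > 0` preserve the
direction of time, those with `Λ 0 0 < 0` reverse it. -/
@[ext]
structure Poincare where
  Λ : Matrix (Fin 4) (Fin 4) ℝ
  a : Mink
  lorentz : Λᵀ * eta * Λ = eta
  det_eq_one : Λ.det = 1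

theorem eta_mul_eta : eta * eta = 1 := by
  rw [eta, Matrix.diagonal_mul_diagonal, ← Matrix.diagonal_one]
  congr 1
  ext i
  fin_cases i <;> simp

theorem lorentz_inv_mul {Λ : Matrix (Fin 4) (Fin 4) ℝ} (h : Λᵀ * eta * Λ = eta) :
    (eta * Λᵀ * eta) * Λ = 1 := by
  rw [Matrix.mul_assoc, Matrix.mul_assoc, ← Matrix.mul_assoc Λᵀ, h, eta_mul_eta]

theorem lorentz_mul_inv {Λ : Matrix (Fin 4) (Fin 4) ℝ} (h : Λᵀ * eta * Λ = eta) :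
    Λ * (eta * Λᵀ * eta) = 1 :=
  mul_eq_one_comm.mp (lorentz_inv_mul h)

namespace Poincare

/-- The action `x ↦ Λ x + a` on Minkowski space. -/
def act (g : Poincare) (x : Mink) : Mink := g.Λ *ᵥ x + g.a

instance : One Poincare := ⟨⟨1, 0, by simp, by simp⟩⟩

instance : Mul Poincare :=
  ⟨fun g h => ⟨g.Λ * h.Λ, g.a + g.Λ *ᵥ h.a, by
    have : (g.Λ * h.Λ)ᵀ * eta * (g.Λ * h.Λ) = h.Λᵀ * (g.Λᵀ * eta * g.Λ) * h.Λ := by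
      simp only [Matrix.transpose_mul, Matrix.mul_assoc]
    rw [this, g.lorentz, h.lorentz], by
    rw [Matrix.det_mul, g.det_eq_one, h.det_eq_one, one_mul]⟩⟩

instance : Inv Poincare :=
  ⟨fun g => ⟨eta * g.Λᵀ * eta, -((eta * g.Λᵀ * eta) *ᵥ g.a), by
    have ht : etaᵀ = eta := by simp [eta]
    have h1 : (eta * g.Λᵀ * eta)ᵀ = eta * g.Λ * eta := by
      simp only [Matrix.transpose_mul, Matrix.transpose_transpose, ht, Matrix.mul_assoc]
    have h2 : g.Λ * (eta * g.Λᵀ * eta) = 1 := lorentz_mul_inv g.lorentz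
    rw [h1, Matrix.mul_assoc (eta * g.Λ), eta_mul_eta, Matrix.mul_one, Matrix.mul_assoc, h2,
      Matrix.mul_one], by
    have h2 := congrArg Matrix.det (lorentz_mul_inv g.lorentz)
    rw [Matrix.det_mul, g.det_eq_one, one_mul, Matrix.det_one] at h2
    exact h2⟩⟩

theorem one_Λ : (1 : Poincare).Λ = 1 := rfl
theorem one_a : (1 : Poincare).a = 0 := rfl
theorem mul_Λ (g h : Poincare) : (g * h).Λ = g.Λ * h.Λ := rfl
theorem mul_a (g h : Poincare) : (g * h).a = g.a + g.Λ *ᵥ h.a := rfl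
theorem inv_Λ (g : Poincare) : (g⁻¹).Λ = eta * g.Λᵀ * eta := rfl
theorem inv_a (g : Poincare) : (g⁻¹).a = -((eta * g.Λᵀ * eta) *ᵥ g.a) := rfl

instance : Group Poincare :=
  Group.ofLeftAxioms
    (fun g h k => by
      ext1
      · simp only [mul_Λ, Matrix.mul_assoc]
      · simp only [mul_a, mul_Λ, Matrix.mulVec_add, Matrix.mulVec_mulVec, add_assoc])
    (fun g => by
      ext1
      · simp only [mul_Λ, one_Λ, Matrix.one_mul]
      · simp only [mul_a, one_a, one_Λ, Matrix.one_mulVec, zero_add])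
    (fun g => by
      ext1
      · simp only [mul_Λ, one_Λ, inv_Λ, lorentz_inv_mul g.lorentz]
      · simp only [mul_a, inv_a, inv_Λ, one_a, neg_add_cancel])

/-- The usual topology, that of the matrix and vector entries. -/
instance : TopologicalSpace Poincare :=
  TopologicalSpace.induced (fun g => (g.Λ, g.a)) inferInstance

/-- The translation by `a`. -/
def translation (a : Mink) : Poincare := ⟨1, a, by simp, by simp⟩

/-- The standard boost in the `t-x` plane with rapidity `χ`:
`t ↦ t cosh χ - x sinh χ`, `x ↦ x cosh χ - t sinh χ`. -/
def boost (χ : ℝ) : Poincare where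
  Λ := !![Real.cosh χ, -Real.sinh χ, 0, 0;
          -Real.sinh χ, Real.cosh χ, 0, 0;
          0, 0, 1, 0;
          0, 0, 0, 1]
  a := 0
  lorentz := by
    have h := Real.cosh_sq χ
    ext i j
    fin_cases i <;> fin_cases j <;>
      simp [eta, Matrix.mul_apply, Fin.sum_univ_four, Matrix.diagonal] <;> nlinarith
  det_eq_one := by
    have h := Real.cosh_sq χ
    simp [Matrix.det_succ_row_zero, Fin.sum_univ_succ, Fin.succAbove]
    nlinarith

/-- The standard reflection `(t, x, y, z) ↦ (-t, -x, y, z)`. -/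
def reflection : Poincare where
  Λ := Matrix.diagonal ![-1, -1, 1, 1]
  a := 0
  lorentz := by
    simp only [eta, Matrix.diagonal_transpose, Matrix.diagonal_mul_diagonal]
    congr 1
    ext i
    fin_cases i <;> simp
  det_eq_one := by simp [Matrix.det_diagonal, Fin.prod_univ_four]

theorem continuous_boost : Continuous boost := by
  refine continuous_induced_rng.mpr (Continuous.prodMk ?_ continuous_const)
  refine continuous_matrix fun i j => ?_
  fin_cases i <;> fin_cases j <;> simp [boost] <;>
    first | exact continuous_const | exact Real.continuous_cosh | exact Real.continuous_sinh.neg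

end Poincare

/-! ### Space-time regions -/

/-- The standard (`t-x`) wedge `x > |t|`. -/
def stdWedge : Set Mink := {v | |v 0| < v 1}

/-- Wedges are the Poincaré transforms of the standard wedge. -/
def IsWedge (W : Set Mink) : Prop := ∃ g : Poincare, W = g.act '' stdWedge

/-- The (open) double cones `(p + V₊) ∩ (q - V₊)` with `q - p ∈ V₊`. -/
def IsDoubleCone (O : Set Mink) : Prop :=
  ∃ p q : Mink, q - p ∈ forwardCone ∧ O = {v | v - p ∈ forwardCone ∧ q - v ∈ forwardCone}

/-- The causal complement: all points spacelike to every point of `O`. -/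
def causalCompl (O : Set Mink) : Set Mink := {v | ∀ w ∈ O, msq (v - w) < 0}

/-! ### Real subspaces of a complex Hilbert space -/

section RealSubspaces

variable {H : Type*} [NormedAddCommGroup H] [InnerProductSpace ℂ H]

/-- The orthogonal complement with respect to the real inner product `Re (ψ, φ)`. -/
def realOrtho (K : Submodule ℝ H) : Submodule ℝ H where
  carrier := {φ | ∀ ψ ∈ K, (⟪ψ, φ⟫_ℂ).re = 0}
  add_mem' {x y} hx hy ψ h := by simp [hx ψ h, hy ψ h]
  zero_mem' ψ _ := by simp
  smul_mem' c x hx ψ h := by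
    rw [← Complex.coe_smul, inner_smul_right, Complex.re_ofReal_mul, hx ψ h, mul_zero]

/-- The symplectic complement, the complement with respect to `Im (ψ, φ)`. -/
def symplCompl (K : Submodule ℝ H) : Submodule ℝ H where
  carrier := {φ | ∀ ψ ∈ K, (⟪ψ, φ⟫_ℂ).im = 0}
  add_mem' {x y} hx hy ψ h := by simp [hx ψ h, hy ψ h]
  zero_mem' ψ _ := by simp
  smul_mem' c x hx ψ h := by
    rw [← Complex.coe_smul, inner_smul_right, Complex.im_ofReal_mul, hx ψ h, mul_zero]

/-- The real subspace `i K`. -/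
def iMul (K : Submodule ℝ H) : Submodule ℝ H where
  carrier := {φ | ∃ ψ ∈ K, φ = Complex.I • ψ}
  add_mem' := by
    rintro _ _ ⟨x, hx, rfl⟩ ⟨y, hy, rfl⟩
    exact ⟨x + y, K.add_mem hx hy, (smul_add _ _ _).symm⟩
  zero_mem' := ⟨0, K.zero_mem, (smul_zero _).symm⟩
  smul_mem' := by
    rintro c _ ⟨x, hx, rfl⟩
    exact ⟨c • x, K.smul_mem c hx, smul_comm _ _ _⟩

end RealSubspaces

/-! ### Functional calculus of a one-parameter unitary group -/

section Calculus

variable {H : Type*} [NormedAddCommGroup H] [InnerProductSpace ℂ H]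

/-- For a unitary group `V t = exp (i t A)` with selfadjoint generator `A` and a smooth compactly
supported function `f` this is `f(A) ψ = ∫ 𝓕f(τ) exp (2 π i τ A) ψ dτ` (Fourier inversion). -/
def smoothCalc (V : ℝ → H → H) (f : ℝ → ℂ) (ψ : H) : H :=
  ∫ τ : ℝ, 𝓕 f τ • V (2 * Real.pi * τ) ψ

/-- `IsExp V c ψ φ` says that `ψ` lies in the domain of the (in general unbounded) selfadjoint
operator `exp (c A)`, where `V t = exp (i t A)`, and that `exp (c A) ψ = φ`.
In terms of the spectral measure of `A`, the condition says that
`f(A) φ = (f · exp (c ·))(A) ψ` for all test functions `f` on the spectrum, that is, `φ` is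
`exp (c A) ψ` on every bounded part of the spectrum. -/
def IsExp (V : ℝ → H → H) (c : ℝ) (ψ φ : H) : Prop :=
  ∀ f : ℝ → ℂ, ContDiff ℝ ∞ f → HasCompactSupport f →
    smoothCalc V f φ = smoothCalc V (fun t => (Real.exp (c * t) : ℂ) * f t) ψ

theorem integrable_fourier_of_test {f : ℝ → ℂ} (hf : ContDiff ℝ ∞ f)
    (hc : HasCompactSupport f) : Integrable (𝓕 f) := by
  have := (𝓕 (hc.toSchwartzMap hf)).integrable (μ := volume)
  rwa [SchwartzMap.fourier_coe] at this

theorem smoothCalc_add {V : ℝ → H ≃ₗᵢ[ℝ] H} (hV : ∀ ψ, Continuous fun t => V t ψ)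
    {f : ℝ → ℂ} (hf : ContDiff ℝ ∞ f) (hc : HasCompactSupport f) (ψ φ : H) :
    smoothCalc (fun t => V t) f (ψ + φ)
      = smoothCalc (fun t => V t) f ψ + smoothCalc (fun t => V t) f φ := by
  have key : ∀ χ : H, Integrable fun τ : ℝ => 𝓕 f τ • V (2 * Real.pi * τ) χ := fun χ => by
    have hi := integrable_fourier_of_test hf hc
    refine (hi.norm.mul_const ‖χ‖).mono' (hi.aestronglyMeasurable.smul
      ((hV χ).comp (continuous_const.mul continuous_id)).aestronglyMeasurable) ?_
    exact Filter.Eventually.of_forall fun τ => by simp [norm_smul]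
  simp only [smoothCalc, map_add, smul_add]
  exact integral_add (key ψ) (key φ)

theorem smoothCalc_smul (V : ℝ → H ≃ₗᵢ[ℝ] H) (f : ℝ → ℂ) (c : ℝ) (ψ : H) :
    smoothCalc (fun t => V t) f (c • ψ) = c • smoothCalc (fun t => V t) f ψ := by
  simp only [smoothCalc, map_smul, smul_comm _ c]
  exact integral_smul c _

theorem contDiff_exp_mul (c : ℝ) {f : ℝ → ℂ} (hf : ContDiff ℝ ∞ f) :
    ContDiff ℝ ∞ fun t => (Real.exp (c * t) : ℂ) * f t :=
  (Complex.ofRealCLM.contDiff.comp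
    (Real.contDiff_exp.comp (contDiff_const.mul contDiff_id))).mul hf

theorem IsExp.add {V : ℝ → H ≃ₗᵢ[ℝ] H} (hV : ∀ ψ, Continuous fun t => V t ψ) {c : ℝ}
    {ψ φ ψ' φ' : H} (h : IsExp (fun t => V t) c ψ φ) (h' : IsExp (fun t => V t) c ψ' φ') :
    IsExp (fun t => V t) c (ψ + ψ') (φ + φ') := fun f hf hc => by
  rw [smoothCalc_add hV hf hc, smoothCalc_add hV (contDiff_exp_mul c hf) hc.mul_left,
    h f hf hc, h' f hf hc]

theorem IsExp.smul {V : ℝ → H ≃ₗᵢ[ℝ] H} {c : ℝ} (r : ℝ) {ψ φ : H}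
    (h : IsExp (fun t => V t) c ψ φ) : IsExp (fun t => V t) c (r • ψ) (r • φ) :=
  fun f hf hc => by rw [smoothCalc_smul, smoothCalc_smul, h f hf hc]

theorem IsExp.zero (V : ℝ → H ≃ₗᵢ[ℝ] H) (c : ℝ) : IsExp (fun t => V t) c 0 0 :=
  fun f _ _ => by simp [smoothCalc]

end Calculus

/-! ### Wigner representations and modular localization -/

/-- A positive energy representation of the proper Poincaré group on a complex Hilbert space:
strongly continuous, unitary on the transformations that preserve the direction of time and
antiunitary on those that reverse it, such that for every `a` in the closed forward cone the
generator `a·P` of the translations `t ↦ U(t a) = exp (i t a·P)` is a positive operator. -/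
structure WignerRep (H : Type*) [NormedAddCommGroup H] [InnerProductSpace ℂ H] where
  U : Poincare →* (H ≃ₗᵢ[ℝ] H)
  unitary : ∀ g : Poincare, 0 < g.Λ 0 0 → ∀ (c : ℂ) (ψ : H), U g (c • ψ) = c • U g ψ
  antiunitary : ∀ g : Poincare, g.Λ 0 0 < 0 → ∀ (c : ℂ) (ψ : H), U g (c • ψ) = conj c • U g ψ
  continuous : ∀ ψ : H, Continuous fun g => U g ψ
  positive_energy : ∀ a : Mink, 0 ≤ a 0 → 0 ≤ msq a →
    ∀ f : ℝ → ℂ, ContDiff ℝ ∞ f → HasCompactSupport f → tsupport f ⊆ Set.Iio 0 →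
      ∀ ψ : H, smoothCalc (fun t => U (Poincare.translation (t • a))) f ψ = 0

namespace WignerRep

variable {H : Type*} [NormedAddCommGroup H] [InnerProductSpace ℂ H] (R : WignerRep H)

/-- The unitary group `δ^{iτ} = U(Λ(2πτ))`. -/
def modGroup (τ : ℝ) : H ≃ₗᵢ[ℝ] H := R.U (Poincare.boost (2 * Real.pi * τ))

/-- The antiunitary involution `j = U(r)`. -/
def j : H ≃ₗᵢ[ℝ] H := R.U Poincare.reflection

/-- `ψ ∈ dom δ^{1/2}` and `δ^{1/2} ψ = φ`. -/
def IsDeltaHalf (ψ φ : H) : Prop := IsExp (fun τ => R.modGroup τ) (1 / 2) ψ φ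

/-- `ψ ∈ dom s` and `s ψ = χ`, where `s = j δ^{1/2}`. -/
def IsS (ψ χ : H) : Prop := ∃ φ, R.IsDeltaHalf ψ φ ∧ R.j φ = χ

theorem continuous_modGroup (ψ : H) : Continuous fun τ => R.modGroup τ ψ :=
  (R.continuous ψ).comp (Poincare.continuous_boost.comp (continuous_const.mul continuous_id))

/-- The real subspace `H_R` of the standard wedge: the eigenspace of `s` to the eigenvalue `-1`. -/
def stdSpace : Submodule ℝ H where
  carrier := {ψ | R.IsS ψ (-ψ)}
  add_mem' := by
    rintro x y ⟨φ, h, e⟩ ⟨φ', h', e'⟩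
    exact ⟨φ + φ', h.add R.continuous_modGroup h', by rw [map_add, e, e', neg_add]⟩
  zero_mem' := ⟨0, IsExp.zero _ _, by simp⟩
  smul_mem' := by
    rintro c x ⟨φ, h, e⟩
    exact ⟨c • φ, h.smul c, by rw [map_smul, e, smul_neg]⟩

/-- The real subspace `U(g) K`. -/
def transport (g : Poincare) (K : Submodule ℝ H) : Submodule ℝ H :=
  K.map (R.U g).toLinearEquiv.toLinearMap

/-- `H_R(W) = U(g) H_R` for a wedge `W = g W_stand`.  (That `U(g) H_R` depends on `W` only is part
of the theorem; the intersection over all such `g` avoids a choice.) -/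
def wedgeSpace (W : Set Mink) : Submodule ℝ H :=
  ⨅ (g : Poincare) (_ : W = g.act '' stdWedge), R.transport g R.stdSpace

/-- `H_R(O)`, the intersection of the `H_R(W)` over all wedges `W ⊇ O`. -/
def space (O : Set Mink) : Submodule ℝ H :=
  ⨅ (W : Set Mink) (_ : IsWedge W) (_ : O ⊆ W), R.wedgeSpace W

/-- `H_R(C)` for a region `C` that is the causal complement of a double cone: the closed real
subspace generated by the `H_R(W)` of all wedges `W ⊆ C` (no wedge contains such a region). -/
def complSpace (C : Set Mink) : Submodule ℝ H :=
  (⨆ (W : Set Mink) (_ : IsWedge W) (_ : W ⊆ C), R.wedgeSpace W).topologicalClosure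

end WignerRep

end ModLoc

end

namespace ModLoc

/-! ### Complements of real subspaces -/

section Complements

variable {H : Type*} [NormedAddCommGroup H] [InnerProductSpace ℂ H]

/-! Everything reduces to one operator identity for the standard wedge and to the geometry of
wedges. Since `j` is antiunitary and commutes with every `δ^{iτ}`, it satisfies `j δ^{1/2} =
δ^{-1/2} j`, and `δ^{1/2}` is symmetric. Hence the symplectic complement of `H_R` is `j H_R`
(`im_inner_eq_zero_iff_isExp`, `symplCompl_stdSpace`). As `j = U(r)` and `r` maps the standard wedge
to the opposite one, transport by `U(g)` gives wedge duality (`symplCompl_wedgeSpace`). The space of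
a wedge is well defined because a transformation fixing the standard wedge commutes with `r` and
either commutes with the boosts or inverts them, according to its time direction
(`entries_of_stabilizer`, `transport_le_of_stabilizer`). In both cases its representative commutes
with `δ^{1/2}` and `j`. A wedge lies in `O'` exactly when its opposite contains `O`
(`wedge_subset_causalCompl_iff`). The symplectic complement turns closed spans into intersections,
so `H_R(O')' = H_R(O)`. The other duality relation is the bicommutant property of closed real
subspaces. Isotony is built into the definitions. For `O₁ ⊆ O₂'` a wedge must be fitted between the
two regions, which two null hyperplanes achieve (`exists_wedge_between`). -/

theorem mem_symplCompl {K : Submodule ℝ H} {φ : H} :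
    φ ∈ symplCompl K ↔ ∀ ψ ∈ K, (⟪ψ, φ⟫_ℂ).im = 0 := Iff.rfl

theorem symplCompl_eq_iMul_realOrtho (K : Submodule ℝ H) :
    symplCompl K = iMul (realOrtho K) := by
  ext φ
  constructor
  · intro h
    refine ⟨-(Complex.I • φ), fun ψ hψ => ?_, ?_⟩
    · simp [inner_smul_right, h ψ hψ]
    · simp [smul_smul]
  · rintro ⟨χ, hχ, rfl⟩ ψ hψ
    have := hχ ψ hψ
    simp [this]

/-- The two factors `i` cancel, so the double symplectic complement is the double orthogonal
complement for the real Hilbert space structure `Re (ψ, φ)`. -/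
theorem symplCompl_symplCompl [CompleteSpace H] {K : Submodule ℝ H}
    (hK : IsClosed (K : Set H)) : symplCompl (symplCompl K) = K := by
  let _ : InnerProductSpace ℝ H := InnerProductSpace.rclikeToReal ℂ H
  have h : symplCompl (symplCompl K) = Kᗮᗮ := by
    ext φ
    constructor
    · intro hφ χ hχ
      have hm : Complex.I • χ ∈ symplCompl K := by
        rw [symplCompl_eq_iMul_realOrtho]
        exact ⟨χ, hχ, rfl⟩
      have := hφ _ hm
      change (⟪χ, φ⟫_ℂ).re = 0
      simpa [inner_smul_left] using this
    · intro hφ χ hχ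
      rw [symplCompl_eq_iMul_realOrtho] at hχ
      obtain ⟨ξ, hξ, rfl⟩ := hχ
      have : (⟪ξ, φ⟫_ℂ).re = 0 := hφ ξ hξ
      simp [this]
  rw [h, Submodule.orthogonal_orthogonal_eq_closure, hK.submodule_topologicalClosure_eq]

theorem symplCompl_topologicalClosure (K : Submodule ℝ H) :
    symplCompl K.topologicalClosure = symplCompl K := by
  refine le_antisymm (fun φ hφ ψ hψ => hφ ψ (K.le_topologicalClosure hψ)) fun φ hφ ψ hψ => ?_
  have hc : IsClosed {ψ : H | (⟪ψ, φ⟫_ℂ).im = 0} :=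
    isClosed_eq (by fun_prop) continuous_const
  exact closure_minimal (fun ψ h => hφ ψ h) hc hψ

theorem symplCompl_iSup {ι : Sort*} (K : ι → Submodule ℝ H) :
    symplCompl (⨆ i, K i) = ⨅ i, symplCompl (K i) := by
  ext φ
  simp only [Submodule.mem_iInf]
  constructor
  · intro h i ψ hψ
    exact h ψ (Submodule.mem_iSup_of_mem i hψ)
  · intro h ψ hψ
    induction hψ using Submodule.iSup_induction' with
    | mem i x hx => exact h i x hx
    | zero => simp
    | add x y _ _ hx hy => simp [hx, hy]

/-- Polarization: the real part is determined by norms, so no compatibility of `T` with `i` is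
needed. -/
theorem re_inner_map_map (T : H ≃ₗᵢ[ℝ] H) (ψ φ : H) :
    (⟪T ψ, T φ⟫_ℂ).re = (⟪ψ, φ⟫_ℂ).re := by
  have h1 := norm_add_sq (𝕜 := ℂ) (T ψ) (T φ)
  have h2 := norm_add_sq (𝕜 := ℂ) ψ φ
  rw [← map_add, T.norm_map, T.norm_map, T.norm_map, h2] at h1
  simp only [RCLike.re_to_complex] at h1
  linarith

/-- Real-linear isometries that are complex linear preserve the inner product. -/
theorem inner_map_map_of_linear {T : H ≃ₗᵢ[ℝ] H} (hT : ∀ (c : ℂ) ψ, T (c • ψ) = c • T ψ)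
    (ψ φ : H) : ⟪T ψ, T φ⟫_ℂ = ⟪ψ, φ⟫_ℂ := by
  refine Complex.ext (re_inner_map_map T ψ φ) ?_
  have := re_inner_map_map T (Complex.I • ψ) φ
  rw [hT, inner_smul_left, inner_smul_left] at this
  simpa using this

/-- Real-linear isometries that are antilinear conjugate the inner product. -/
theorem inner_map_map_of_antilinear {T : H ≃ₗᵢ[ℝ] H}
    (hT : ∀ (c : ℂ) ψ, T (c • ψ) = conj c • T ψ) (ψ φ : H) :
    ⟪T ψ, T φ⟫_ℂ = conj ⟪ψ, φ⟫_ℂ := by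
  refine Complex.ext (by rw [Complex.conj_re, re_inner_map_map]) ?_
  have := re_inner_map_map T (Complex.I • ψ) φ
  rw [hT, inner_smul_left, inner_smul_left] at this
  rw [Complex.conj_im]
  simp at this
  linarith

/-- A real-linear isometry that preserves the imaginary part of the inner product up to sign
commutes with the symplectic complement. -/
theorem symplCompl_map {T : H ≃ₗᵢ[ℝ] H}
    (hT : ∀ ψ φ : H, (⟪T ψ, T φ⟫_ℂ).im = 0 ↔ (⟪ψ, φ⟫_ℂ).im = 0) (K : Submodule ℝ H) :
    symplCompl (K.map T.toLinearEquiv.toLinearMap)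
      = (symplCompl K).map T.toLinearEquiv.toLinearMap := by
  ext φ
  constructor
  · intro h
    refine ⟨T.symm φ, fun ψ hψ => ?_, by simp⟩
    rw [← hT, T.apply_symm_apply]
    exact h _ ⟨ψ, hψ, rfl⟩
  · rintro ⟨φ, hφ, rfl⟩ _ ⟨ψ, hψ, rfl⟩
    exact (hT ψ φ).2 (hφ ψ hψ)

end Complements

/-! ### The calculus of a unitary group -/

section Unitary

variable {H : Type*} [NormedAddCommGroup H] [InnerProductSpace ℂ H]

/-- Strongly continuous one-parameter groups of unitary operators. -/
structure IsUnitaryGroup (V : ℝ → H ≃ₗᵢ[ℝ] H) : Prop where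
  add : ∀ s t ψ, V (s + t) ψ = V s (V t ψ)
  smul : ∀ t (c : ℂ) ψ, V t (c • ψ) = c • V t ψ
  cont : ∀ ψ, Continuous fun t => V t ψ

/-! ### Fourier transforms of test functions -/

theorem fourier_conj (f : ℝ → ℂ) (τ : ℝ) : 𝓕 (fun t => conj (f t)) τ = conj (𝓕 f (-τ)) := by
  rw [Real.fourier_real_eq_integral_exp_smul, Real.fourier_real_eq_integral_exp_smul,
    ← integral_conj]
  congr 1
  ext v
  simp only [smul_eq_mul, map_mul, ← Complex.exp_conj, Complex.conj_ofReal, Complex.conj_I]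
  simp

theorem fourier_conj_neg (f : ℝ → ℂ) (τ : ℝ) :
    𝓕 (fun t => conj (f (-t))) τ = conj (𝓕 f τ) := by
  rw [Real.fourier_real_eq_integral_exp_smul, Real.fourier_real_eq_integral_exp_smul,
    ← integral_conj, ← integral_neg_eq_self]
  congr 1
  ext v
  simp only [smul_eq_mul, map_mul, ← Complex.exp_conj, Complex.conj_ofReal, Complex.conj_I]
  simp

/-- The convolution `h` of the two transforms has Fourier transform `f(-x) g(-x)`, so `f g` is the
inverse transform of `h`. Fourier inversion for the continuous integrable `h` then gives the
formula. It underlies the multiplicativity of the calculus. -/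
theorem fourier_mul_eq_integral {f g : ℝ → ℂ} (hf : ContDiff ℝ ∞ f) (hfc : HasCompactSupport f)
    (hg : ContDiff ℝ ∞ g) (hgc : HasCompactSupport g) (s : ℝ) :
    𝓕 (fun t => f t * g t) s = ∫ τ, 𝓕 f τ * 𝓕 g (s - τ) := by
  have hFf := integrable_fourier_of_test hf hfc
  have hFg := integrable_fourier_of_test hg hgc
  have hfi : Integrable f := hf.continuous.integrable_of_hasCompactSupport hfc
  have hgi : Integrable g := hg.continuous.integrable_of_hasCompactSupport hgc
  set h : ℝ → ℂ := convolution (𝓕 f) (𝓕 g) (ContinuousLinearMap.mul ℂ ℂ) volume with hh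
  have hhi : Integrable h := hFf.integrable_convolution _ hFg
  let G : SchwartzMap ℝ ℂ := 𝓕 (hgc.toSchwartzMap hg)
  have hgS : 𝓕 g = G := by rw [SchwartzMap.fourier_coe]; rfl
  have hhc : Continuous h := by
    refine BddAbove.continuous_convolution_right_of_integrable _ ?_ hFf ?_
    · rw [hgS]
      exact ⟨SchwartzMap.seminorm ℝ 0 0 G,
        fun x ⟨y, hy⟩ ↦ hy ▸ SchwartzMap.norm_le_seminorm ℝ _ y⟩
    · rw [hgS]
      exact SchwartzMap.continuous _
  have hFh : ∀ x, 𝓕 h x = f (-x) * g (-x) := fun x => by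
    rw [hh, Real.fourier_mul_convolution_eq hFf hFg]
    have e1 := congrFun (hf.continuous.fourierInv_fourier_eq hfi hFf) (-x)
    have e2 := congrFun (hg.continuous.fourierInv_fourier_eq hgi hFg) (-x)
    rw [Real.fourierInv_eq_fourier_neg, neg_neg] at e1 e2
    rw [e1, e2]
  have hinv : 𝓕⁻ h = fun t => f t * g t := by
    ext x
    rw [Real.fourierInv_eq_fourier_neg, hFh, neg_neg]
  have hFhi : Integrable (𝓕 h) := by
    have : 𝓕 h = fun x => (fun t => f t * g t) (-x) := funext hFh
    rw [this]
    exact ((hf.continuous.mul hg.continuous).integrable_of_hasCompactSupport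
      hfc.mul_right).comp_neg
  rw [← hinv, congrFun (hhc.fourier_fourierInv_eq hhi hFhi) s, hh, convolution_def]
  rfl

variable {V : ℝ → H ≃ₗᵢ[ℝ] H}

theorem IsUnitaryGroup.zero (hV : IsUnitaryGroup V) (ψ : H) : V 0 ψ = ψ := by
  have := hV.add 0 0 ψ
  rw [add_zero] at this
  exact ((V 0).injective this).symm

theorem IsUnitaryGroup.inner_map_map (hV : IsUnitaryGroup V) (t : ℝ) (ψ φ : H) :
    ⟪V t ψ, V t φ⟫_ℂ = ⟪ψ, φ⟫_ℂ := inner_map_map_of_linear (hV.smul t) ψ φ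

theorem IsUnitaryGroup.inner_map_left (hV : IsUnitaryGroup V) (t : ℝ) (ψ φ : H) :
    ⟪V t ψ, φ⟫_ℂ = ⟪ψ, V (-t) φ⟫_ℂ := by
  rw [← hV.inner_map_map (-t), ← hV.add, neg_add_cancel, hV.zero]

theorem IsUnitaryGroup.integrable_smul (hV : IsUnitaryGroup V) {F : ℝ → ℂ} (hF : Integrable F)
    (ψ : H) : Integrable fun τ : ℝ => F τ • V (2 * Real.pi * τ) ψ := by
  refine (hF.norm.mul_const ‖ψ‖).mono' (hF.aestronglyMeasurable.smul
    ((hV.cont ψ).comp (continuous_const.mul continuous_id)).aestronglyMeasurable) ?_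
  exact Filter.Eventually.of_forall fun τ => by simp [norm_smul]

theorem norm_smoothCalc_le (V : ℝ → H ≃ₗᵢ[ℝ] H) (f : ℝ → ℂ) (ψ : H) :
    ‖smoothCalc (fun t => V t) f ψ‖ ≤ (∫ τ, ‖𝓕 f τ‖) * ‖ψ‖ := by
  refine (norm_integral_le_integral_norm _).trans (le_of_eq ?_)
  rw [← integral_mul_const]
  congr 1
  ext τ
  simp [norm_smul]

theorem smoothCalc_neg (V : ℝ → H ≃ₗᵢ[ℝ] H) (f : ℝ → ℂ) (ψ : H) :
    smoothCalc (fun t => V t) f (-ψ) = -smoothCalc (fun t => V t) f ψ := by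
  simpa using smoothCalc_smul V f (-1) ψ

theorem continuous_smoothCalc (hV : IsUnitaryGroup V) {f : ℝ → ℂ} (hf : ContDiff ℝ ∞ f)
    (hc : HasCompactSupport f) : Continuous (smoothCalc (fun t => V t) f) := by
  refine (LipschitzWith.of_dist_le_mul (K := ⟨∫ τ, ‖𝓕 f τ‖, by positivity⟩)
    fun x y => ?_).continuous
  rw [dist_eq_norm, dist_eq_norm, sub_eq_add_neg, ← smoothCalc_neg,
    ← smoothCalc_add hV.cont hf hc, ← sub_eq_add_neg]
  exact norm_smoothCalc_le V f _

theorem hasCompactSupport_conj {f : ℝ → ℂ} (hc : HasCompactSupport f) :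
    HasCompactSupport fun t => conj (f t) := hc.comp_left (g := conj) (map_zero _)

theorem contDiff_conj {f : ℝ → ℂ} (hf : ContDiff ℝ ∞ f) : ContDiff ℝ ∞ fun t => conj (f t) :=
  Complex.conjCLE.contDiff.comp hf

theorem contDiff_conj_neg {f : ℝ → ℂ} (hf : ContDiff ℝ ∞ f) :
    ContDiff ℝ ∞ fun t => conj (f (-t)) :=
  contDiff_conj (hf.comp contDiff_neg)

theorem hasCompactSupport_conj_neg {f : ℝ → ℂ} (hc : HasCompactSupport f) :
    HasCompactSupport fun t => conj (f (-t)) :=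
  hasCompactSupport_conj (hc.comp_homeomorph (Homeomorph.neg ℝ))

theorem map_integral_isometry (T : H ≃ₗᵢ[ℝ] H) (F : ℝ → H) :
    T (∫ τ, F τ) = ∫ τ, T (F τ) :=
  (T.toContinuousLinearEquiv.integral_comp_comm F).symm

/-- The graph of `exp (c A)` is cut out by equations between bounded operators, one for each test
function. -/
theorem isClosed_isExp (hV : IsUnitaryGroup V) (c : ℝ) :
    IsClosed {p : H × H | IsExp (fun t => V t) c p.1 p.2} := by
  simp only [IsExp, Set.ofPred_forall]
  refine isClosed_iInter fun f => isClosed_iInter fun hf => isClosed_iInter fun hc => ?_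
  exact isClosed_eq ((continuous_smoothCalc hV hf hc).comp continuous_snd)
    ((continuous_smoothCalc hV (contDiff_exp_mul c hf) hc.mul_left).comp continuous_fst)

/-- An operator that commutes with the unitary group commutes with its calculus. -/
theorem map_smoothCalc_of_linear {T : H ≃ₗᵢ[ℝ] H} (hT : ∀ (c : ℂ) ψ, T (c • ψ) = c • T ψ)
    (hTV : ∀ t ψ, T (V t ψ) = V t (T ψ)) (f : ℝ → ℂ) (ψ : H) :
    T (smoothCalc (fun t => V t) f ψ) = smoothCalc (fun t => V t) f (T ψ) := by
  simp only [smoothCalc, map_integral_isometry, hT, hTV]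

/-- An antilinear `T` commuting with `exp (i t A)` anticommutes with `A`, hence the reflected
argument. -/
theorem map_smoothCalc_of_antilinear {T : H ≃ₗᵢ[ℝ] H}
    (hT : ∀ (c : ℂ) ψ, T (c • ψ) = conj c • T ψ)
    (hTV : ∀ t ψ, T (V t ψ) = V t (T ψ)) (f : ℝ → ℂ) (ψ : H) :
    T (smoothCalc (fun t => V t) f ψ)
      = smoothCalc (fun t => V t) (fun t => conj (f (-t))) (T ψ) := by
  simp only [smoothCalc, map_integral_isometry, hT, hTV, fourier_conj_neg]

/-- Here the reversal of `t` compensates the conjugation of `i`, so that `T` commutes with `A`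
itself. -/
theorem map_smoothCalc_of_antilinear_of_neg {T : H ≃ₗᵢ[ℝ] H}
    (hT : ∀ (c : ℂ) ψ, T (c • ψ) = conj c • T ψ)
    (hTV : ∀ t ψ, T (V t ψ) = V (-t) (T ψ)) (f : ℝ → ℂ) (ψ : H) :
    T (smoothCalc (fun t => V t) f ψ)
      = smoothCalc (fun t => V t) (fun t => conj (f t)) (T ψ) := by
  simp only [smoothCalc, map_integral_isometry, hT, hTV, fourier_conj]
  rw [← integral_neg_eq_self]
  simp

theorem IsExp.map_of_linear {T : H ≃ₗᵢ[ℝ] H} (hT : ∀ (c : ℂ) ψ, T (c • ψ) = c • T ψ)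
    (hTV : ∀ t ψ, T (V t ψ) = V t (T ψ)) {c : ℝ} {ψ φ : H} (h : IsExp (fun t => V t) c ψ φ) :
    IsExp (fun t => V t) c (T ψ) (T φ) := fun f hf hc => by
  rw [← map_smoothCalc_of_linear hT hTV, h f hf hc, map_smoothCalc_of_linear hT hTV]

theorem IsExp.map_of_antilinear_of_neg {T : H ≃ₗᵢ[ℝ] H}
    (hT : ∀ (c : ℂ) ψ, T (c • ψ) = conj c • T ψ)
    (hTV : ∀ t ψ, T (V t ψ) = V (-t) (T ψ)) {c : ℝ} {ψ φ : H}
    (h : IsExp (fun t => V t) c ψ φ) : IsExp (fun t => V t) c (T ψ) (T φ) := fun f hf hc => by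
  have := congrArg T (h _ (contDiff_conj hf) (hasCompactSupport_conj hc))
  rw [map_smoothCalc_of_antilinear_of_neg hT hTV,
    map_smoothCalc_of_antilinear_of_neg hT hTV] at this
  simpa only [map_mul, Complex.conj_conj, Complex.conj_ofReal] using this

/-- `j δ^{c} = δ^{-c} j` for an antiunitary `j` commuting with `δ^{iτ}`. -/
theorem IsExp.map_of_antilinear {T : H ≃ₗᵢ[ℝ] H}
    (hT : ∀ (c : ℂ) ψ, T (c • ψ) = conj c • T ψ)
    (hTV : ∀ t ψ, T (V t ψ) = V t (T ψ)) {c : ℝ} {ψ φ : H}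
    (h : IsExp (fun t => V t) c ψ φ) : IsExp (fun t => V t) c (T φ) (T ψ) := fun f hf hc => by
  -- Reflection and conjugation turn this test function into `exp (c t) f(t)`. Multiplied by `exp (c
  -- t)` beforehand, it becomes `f(t)`.
  have := congrArg T (h (fun t => (Real.exp (-c * t) : ℂ) * conj (f (-t)))
    (contDiff_exp_mul (-c) (contDiff_conj_neg hf)) (hasCompactSupport_conj_neg hc).mul_left)
  rw [map_smoothCalc_of_antilinear hT hTV, map_smoothCalc_of_antilinear hT hTV] at this
  simp only [map_mul, Complex.conj_conj, Complex.conj_ofReal, neg_neg, ← mul_assoc,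
    ← Complex.ofReal_mul, ← Real.exp_add, neg_mul_neg] at this
  simpa using this.symm

/-! ### Adjoints, products and symmetry in the functional calculus -/

variable [CompleteSpace H]

/-- The adjoint of `f(A)` is `conj f (A)`. -/
theorem inner_smoothCalc_left (hV : IsUnitaryGroup V) {f : ℝ → ℂ} (hf : ContDiff ℝ ∞ f)
    (hc : HasCompactSupport f) (ψ φ : H) :
    ⟪smoothCalc (fun t => V t) f ψ, φ⟫_ℂ
      = ⟪ψ, smoothCalc (fun t => V t) (fun t => conj (f t)) φ⟫_ℂ := by
  have hi := hV.integrable_smul (integrable_fourier_of_test hf hc) ψ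
  have hi' := hV.integrable_smul
    (integrable_fourier_of_test (contDiff_conj hf) (hasCompactSupport_conj hc)) φ
  rw [← inner_conj_symm, smoothCalc, smoothCalc, ← integral_inner hi, ← integral_inner hi',
    ← integral_conj, ← integral_neg_eq_self]
  congr 1
  ext τ
  rw [inner_conj_symm, inner_smul_left, inner_smul_right, hV.inner_map_left, fourier_conj]
  simp

/-- Multiplicativity of the functional calculus. -/
theorem smoothCalc_smoothCalc (hV : IsUnitaryGroup V) {f g : ℝ → ℂ} (hf : ContDiff ℝ ∞ f)
    (hfc : HasCompactSupport f) (hg : ContDiff ℝ ∞ g) (hgc : HasCompactSupport g) (ψ : H) :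
    smoothCalc (fun t => V t) f (smoothCalc (fun t => V t) g ψ)
      = smoothCalc (fun t => V t) (fun t => f t * g t) ψ := by
  have hFf := integrable_fourier_of_test hf hfc
  have hFg := integrable_fourier_of_test hg hgc
  have hint : Integrable (Function.uncurry fun (s τ : ℝ) =>
      (𝓕 f τ * 𝓕 g (s - τ)) • V (2 * Real.pi * s) ψ) (volume.prod volume) := by
    have h0 := hFf.convolution_integrand (ContinuousLinearMap.mul ℂ ℂ) hFg
    refine (h0.norm.mul_const ‖ψ‖).mono' (h0.aestronglyMeasurable.smul
      ((hV.cont ψ).comp (continuous_const.mul continuous_fst)).aestronglyMeasurable) ?_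
    exact Filter.Eventually.of_forall fun τ => by simp [Function.uncurry, norm_smul]
  calc smoothCalc (fun t => V t) f (smoothCalc (fun t => V t) g ψ)
      = ∫ τ, ∫ s, (𝓕 f τ * 𝓕 g (s - τ)) • V (2 * Real.pi * s) ψ := by
        unfold smoothCalc
        congr 1
        ext τ
        beta_reduce
        rw [map_integral_isometry, ← integral_smul,
          -- Substituting `σ = s - τ` collects both group elements into `V (2πs)`.
          ← integral_sub_right_eq_self (fun σ => 𝓕 f τ • V (2 * Real.pi * τ)
            (𝓕 g σ • V (2 * Real.pi * σ) ψ)) τ]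
        congr 1
        ext s
        rw [hV.smul, ← hV.add, smul_smul]
        congr 2
        ring_nf
    _ = ∫ s, ∫ τ, (𝓕 f τ * 𝓕 g (s - τ)) • V (2 * Real.pi * s) ψ :=
        (integral_integral_swap hint).symm
    _ = smoothCalc (fun t => V t) (fun t => f t * g t) ψ := by
        unfold smoothCalc
        congr 1
        ext s
        rw [fourier_mul_eq_integral hf hfc hg hgc, integral_smul_const]

/-- Vectors cut off to a bounded part of the spectrum lie in the domain of `exp (c A)`. They are the
test vectors for modular duality. -/
theorem IsExp.smoothCalc_smoothCalc (hV : IsUnitaryGroup V) (c : ℝ) {f : ℝ → ℂ}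
    (hf : ContDiff ℝ ∞ f) (hfc : HasCompactSupport f) (ψ : H) :
    IsExp (fun t => V t) c (smoothCalc (fun t => V t) f ψ)
      (smoothCalc (fun t => V t) (fun t => (Real.exp (c * t) : ℂ) * f t) ψ) := by
  intro g hg hgc
  rw [ModLoc.smoothCalc_smoothCalc hV hg hgc (contDiff_exp_mul c hf) hfc.mul_left,
    ModLoc.smoothCalc_smoothCalc hV (contDiff_exp_mul c hg) hgc.mul_left hf hfc]
  congr 1
  ext t
  ring

/-- Spectral cutoffs: a real bump function equal to 1 near 0 is stretched by `n + 1`. Its transform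
concentrates at 0 with integral 1, so strong continuity and dominated convergence give the limit. -/
theorem exists_test_tendsto (hV : IsUnitaryGroup V) :
    ∃ f : ℕ → ℝ → ℂ, (∀ n, ContDiff ℝ ∞ (f n)) ∧ (∀ n, HasCompactSupport (f n)) ∧
      (∀ n t, conj (f n t) = f n t) ∧
      ∀ ψ : H, Filter.Tendsto (fun n => smoothCalc (fun t => V t) (f n) ψ) Filter.atTop
        (nhds ψ) := by
  let b : ContDiffBump (0 : ℝ) := ⟨1, 2, one_pos, one_lt_two⟩
  let g : ℝ → ℂ := fun t => (b t : ℂ)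
  have hg : ContDiff ℝ ∞ g := Complex.ofRealCLM.contDiff.comp b.contDiff
  have hgc : HasCompactSupport g := b.hasCompactSupport.comp_left (g := Complex.ofReal) rfl
  have hFg := integrable_fourier_of_test hg hgc
  have hn : ∀ n : ℕ, (0 : ℝ) < ((n : ℝ) + 1)⁻¹ := fun n => by positivity
  have hF1 : ∫ τ, 𝓕 g τ = 1 := by
    have h := congrFun (hg.continuous.fourierInv_fourier_eq
      (hg.continuous.integrable_of_hasCompactSupport hgc) hFg) 0
    have hg0 : g 0 = 1 := by
      simp [g, b.one_of_mem_closedBall (Metric.mem_closedBall_self b.rIn_pos.le)]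
    rw [hg0, Real.fourierInv_eq_fourier_neg, Real.fourier_real_eq_integral_exp_smul] at h
    simpa using h
  refine ⟨fun n t => g (((n : ℝ) + 1)⁻¹ * t), fun n => ?_, fun n => ?_, fun n t => ?_,
    fun ψ => ?_⟩
  · exact hg.comp (contDiff_const.mul contDiff_id)
  · exact hgc.comp_homeomorph (Homeomorph.mulLeft₀ _ (hn n).ne')
  · simp [g]
  have hscale : ∀ (n : ℕ) (τ : ℝ), 𝓕 (fun t => g (((n : ℝ) + 1)⁻¹ * t)) τ
      = ((n : ℝ) + 1 : ℝ) • 𝓕 g (((n : ℝ) + 1) * τ) := fun n τ => by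
    have hpos : (0 : ℝ) < (n : ℝ) + 1 := by positivity
    rw [Real.fourier_real_eq_integral_exp_smul, Real.fourier_real_eq_integral_exp_smul]
    have := Measure.integral_comp_mul_left (fun v : ℝ =>
      Complex.exp (↑(-2 * Real.pi * v * (((n : ℝ) + 1) * τ)) * Complex.I) • g v)
      (((n : ℝ) + 1)⁻¹)
    rw [inv_inv, abs_of_pos hpos] at this
    rw [← this]
    congr 1
    ext v
    congr 4
    field_simp
  have hcalc : ∀ n : ℕ, smoothCalc (fun t => V t) (fun t => g (((n : ℝ) + 1)⁻¹ * t)) ψ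
      = ∫ τ, 𝓕 g τ • V (2 * Real.pi * (((n : ℝ) + 1)⁻¹ * τ)) ψ := fun n => by
    have hpos : (0 : ℝ) < (n : ℝ) + 1 := by positivity
    have := Measure.integral_comp_mul_left (fun τ : ℝ =>
      𝓕 g τ • V (2 * Real.pi * (((n : ℝ) + 1)⁻¹ * τ)) ψ) ((n : ℝ) + 1)
    rw [abs_of_pos (inv_pos.2 hpos), eq_inv_smul_iff₀ hpos.ne', ← integral_smul] at this
    rw [← this, smoothCalc]
    congr 1
    ext τ
    rw [hscale, inv_mul_cancel_left₀ hpos.ne', smul_assoc]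
  simp only [hcalc]
  have hlim : ∫ τ, 𝓕 g τ • ψ = ψ := by rw [integral_smul_const, hF1, one_smul]
  conv => rhs; rw [← hlim]
  refine tendsto_integral_of_dominated_convergence (fun τ => ‖𝓕 g τ‖ * ‖ψ‖) (fun n => ?_)
    (hFg.norm.mul_const _) (fun n => Filter.Eventually.of_forall fun τ => by simp [norm_smul])
    (Filter.Eventually.of_forall fun τ => ?_)
  · exact hFg.aestronglyMeasurable.smul
      ((hV.cont ψ).comp (by fun_prop)).aestronglyMeasurable
  · refine Filter.Tendsto.const_smul ?_ _
    have h0 : Filter.Tendsto (fun n : ℕ => 2 * Real.pi * (((n : ℝ) + 1)⁻¹ * τ)) Filter.atTop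
        (nhds (2 * Real.pi * (0 * τ))) := by
      refine (Filter.Tendsto.mul_const τ ?_).const_mul _
      simpa [one_div] using tendsto_one_div_add_atTop_nhds_zero_nat (𝕜 := ℝ)
    have := ((hV.cont ψ).tendsto _).comp h0
    rw [zero_mul, mul_zero, hV.zero] at this
    exact this

/-- `exp (c A)` is symmetric. -/
theorem IsExp.inner_eq (hV : IsUnitaryGroup V) {c : ℝ} {ψ ψ' φ φ' : H}
    (h : IsExp (fun t => V t) c ψ ψ') (h' : IsExp (fun t => V t) c φ φ') :
    ⟪ψ', φ⟫_ℂ = ⟪ψ, φ'⟫_ℂ := by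
  obtain ⟨f, hf, hfc, hreal, hlim⟩ := exists_test_tendsto hV
  -- Under the cutoff `exp (c A)` becomes the calculus of a real test function, which is selfadjoint
  -- and can be moved across.
  have key : ∀ n, ⟪smoothCalc (fun t => V t) (f n) ψ', φ⟫_ℂ
      = ⟪ψ, smoothCalc (fun t => V t) (f n) φ'⟫_ℂ := fun n => by
    rw [h _ (hf n) (hfc n), h' _ (hf n) (hfc n),
      inner_smoothCalc_left hV (contDiff_exp_mul c (hf n)) (hfc n).mul_left]
    simp only [map_mul, hreal, Complex.conj_ofReal]
  refine tendsto_nhds_unique ((hlim ψ').inner tendsto_const_nhds) ?_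
  simp only [key]
  exact tendsto_const_nhds.inner (hlim φ')

/-- Modular duality: the symplectic complement of `{ψ | j δ^{1/2} ψ = -ψ}` is its image
under `j`. -/
theorem im_inner_eq_zero_iff_isExp (hV : IsUnitaryGroup V) {J : H ≃ₗᵢ[ℝ] H}
    (hJ : ∀ (c : ℂ) ψ, J (c • ψ) = conj c • J ψ) (hJJ : ∀ ψ, J (J ψ) = ψ)
    (hJV : ∀ t ψ, J (V t ψ) = V t (J ψ)) (c : ℝ) (φ : H) :
    (∀ ψ, IsExp (fun t => V t) c ψ (-J ψ) → (⟪ψ, φ⟫_ℂ).im = 0) ↔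
      IsExp (fun t => V t) c (J φ) (-φ) := by
  have hJi : ∀ ψ φ, ⟪J ψ, φ⟫_ℂ = conj ⟪ψ, J φ⟫_ℂ := fun ψ φ => by
    rw [← inner_map_map_of_antilinear hJ, hJJ]
  constructor
  · intro h f hf hfc
    refine ext_inner_left ℂ fun ξ => ?_
    -- With `ζ = exp (c A) η`, both `η - J ζ` and `i (η + J ζ)` satisfy the relation `exp (c A) ψ =
    -- -J ψ`. They provide the imaginary and the real part of `⟪η, φ⟫ = -⟪ζ, J φ⟫`; moving the
    -- calculus off the arbitrary `ξ` gives the claim.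
    set η := smoothCalc (fun t => V t) (fun t => conj (f t)) ξ with hη
    set ζ := smoothCalc (fun t => V t) (fun t => (Real.exp (c * t) : ℂ) * conj (f t)) ξ with hζ
    have hE : IsExp (fun t => V t) c η ζ :=
      IsExp.smoothCalc_smoothCalc hV c (contDiff_conj hf) (hasCompactSupport_conj hfc) ξ
    have hE' : IsExp (fun t => V t) c (J ζ) (J η) := hE.map_of_antilinear hJ hJV
    have hI : ∀ {a b : H}, IsExp (fun t => V t) c a b →
        IsExp (fun t => V t) c (Complex.I • a) (Complex.I • b) := by
      intro a b hab g hg hgc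
      simp only [smoothCalc, hV.smul]
      have := congrArg (fun x => Complex.I • x) (hab g hg hgc)
      simp only [smoothCalc, ← integral_smul] at this
      simpa only [smul_comm Complex.I] using this
    have h1 := h (η + (-1 : ℝ) • J ζ) <| by
      convert hE.add hV.cont (hE'.smul (-1)) using 1
      simp [hJJ]
    have h2 := h (Complex.I • η + Complex.I • J ζ) <| by
      convert (hI hE).add hV.cont (hI hE') using 1
      simp [hJ, hJJ]
    have key : ⟪η, φ⟫_ℂ = -⟪ζ, J φ⟫_ℂ := by
      have e : ⟪J ζ, φ⟫_ℂ = conj ⟪ζ, J φ⟫_ℂ := hJi ζ φ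
      rw [inner_add_left] at h1 h2
      rw [neg_one_smul, inner_neg_left, e] at h1
      rw [inner_smul_left, inner_smul_left, e] at h2
      generalize ⟪ζ, J φ⟫_ℂ = z at h1 h2 ⊢
      simp at h1 h2
      refine Complex.ext ?_ ?_ <;> simp <;> linarith
    rw [hη, hζ, inner_smoothCalc_left hV (contDiff_conj hf) (hasCompactSupport_conj hfc),
      inner_smoothCalc_left hV (contDiff_exp_mul c (contDiff_conj hf))
        (hasCompactSupport_conj hfc).mul_left] at key
    simp only [map_mul, Complex.conj_conj, Complex.conj_ofReal] at key
    rw [smoothCalc_neg, inner_neg_right, key, neg_neg]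
  · intro h ψ hψ
    -- Symmetry of `exp (c A)` applied to `ψ` and `J φ` says that `⟪ψ, φ⟫` equals its own conjugate.
    have e := hψ.inner_eq hV h
    rw [inner_neg_left, inner_neg_right, neg_inj, hJi, hJJ] at e
    exact Complex.conj_eq_iff_im.1 e

end Unitary

/-! ### The Minkowski form and the action of the Poincaré group -/

/-- The Minkowski inner product. -/
noncomputable def mdot (v w : Mink) : ℝ := v ⬝ᵥ (eta *ᵥ w)

theorem mdot_eq (v w : Mink) : mdot v w = v 0 * w 0 - v 1 * w 1 - v 2 * w 2 - v 3 * w 3 := by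
  simp [mdot, eta, Matrix.mulVec_diagonal, dotProduct, Fin.sum_univ_four]
  ring

theorem msq_eq (v : Mink) : msq v = v 0 ^ 2 - v 1 ^ 2 - v 2 ^ 2 - v 3 ^ 2 := by
  change mdot v v = _
  rw [mdot_eq]
  ring

theorem mdot_mulVec (g : Poincare) (v w : Mink) : mdot (g.Λ *ᵥ v) (g.Λ *ᵥ w) = mdot v w := by
  rw [mdot, mdot, Matrix.mulVec_mulVec, ← Matrix.vecMul_transpose, ← Matrix.dotProduct_mulVec,
    Matrix.mulVec_mulVec, ← Matrix.mul_assoc, g.lorentz]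

theorem mul_eta_mul_transpose_apply (A B : Matrix (Fin 4) (Fin 4) ℝ) (i j : Fin 4) :
    (A * eta * Bᵀ) i j = mdot (A i) (B j) := by
  rw [mdot_eq, eta]
  simp [Matrix.mul_apply (M := A * _), Fin.sum_univ_four]
  ring

theorem msq_mulVec (g : Poincare) (v : Mink) : msq (g.Λ *ᵥ v) = msq v := mdot_mulVec g v v

namespace Poincare

theorem one_act (x : Mink) : (1 : Poincare).act x = x := by simp [act, one_Λ, one_a]

theorem mul_act (g h : Poincare) (x : Mink) : (g * h).act x = g.act (h.act x) := by
  simp only [act, mul_Λ, mul_a, Matrix.mulVec_add, Matrix.mulVec_mulVec]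
  abel

theorem inv_act_act (g : Poincare) (x : Mink) : g⁻¹.act (g.act x) = x := by
  rw [← mul_act, inv_mul_cancel, one_act]

theorem act_inv_act (g : Poincare) (x : Mink) : g.act (g⁻¹.act x) = x := by
  rw [← mul_act, mul_inv_cancel, one_act]

theorem image_mul_act (g h : Poincare) (S : Set Mink) :
    (g * h).act '' S = g.act '' (h.act '' S) := by
  rw [Set.image_image]
  simp only [mul_act]

theorem mem_image_act {g : Poincare} {S : Set Mink} {v : Mink} :
    v ∈ g.act '' S ↔ g⁻¹.act v ∈ S := by
  constructor
  · rintro ⟨x, hx, rfl⟩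
    rwa [inv_act_act]
  · exact fun h => ⟨_, h, act_inv_act g v⟩

theorem msq_act_sub_act (g : Poincare) (x y : Mink) : msq (g.act x - g.act y) = msq (x - y) := by
  rw [← msq_mulVec g (x - y), act, act, add_sub_add_right_eq_sub, Matrix.mulVec_sub]

theorem mdot_row (g : Poincare) (i j : Fin 4) : mdot (g.Λ i) (g.Λ j) = eta i j := by
  have h : g.Λ * eta * g.Λᵀ = eta := by
    have := congrArg (· * eta) (lorentz_mul_inv g.lorentz)
    simpa only [Matrix.mul_assoc, eta_mul_eta, Matrix.mul_one, Matrix.one_mul] using this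
  rw [← mul_eta_mul_transpose_apply, h]

theorem reflection_act (v : Mink) : reflection.act v = ![-v 0, -v 1, v 2, v 3] := by
  ext i
  fin_cases i <;> simp [act, reflection, Matrix.mulVec_diagonal]

theorem reflection_mul_reflection : reflection * reflection = 1 := by
  ext1
  · rw [mul_Λ, one_Λ, reflection, Matrix.diagonal_mul_diagonal, ← Matrix.diagonal_one]
    congr 1
    ext i
    fin_cases i <;> simp
  · simp [mul_a, one_a, reflection]

theorem boost_add (s t : ℝ) : boost (s + t) = boost s * boost t := by
  ext1
  · rw [mul_Λ]
    ext i j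
    fin_cases i <;> fin_cases j <;>
      simp [boost, Matrix.mul_apply, Fin.sum_univ_four, Real.cosh_add, Real.sinh_add] <;> ring
  · simp [mul_a, boost]

theorem reflection_mul_boost (χ : ℝ) : reflection * boost χ = boost χ * reflection := by
  ext1
  · rw [mul_Λ, mul_Λ, reflection]
    ext i j
    rw [Matrix.diagonal_mul, Matrix.mul_diagonal]
    fin_cases i <;> fin_cases j <;> simp [boost]
  · simp [mul_a, boost, reflection]

/-- The form of the Poincaré transformations that map the standard wedge onto itself. -/
theorem entries_of_stabilizer {g : Poincare} (hg : g.act '' stdWedge = stdWedge) :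
    (∀ i : Fin 4, i = 0 ∨ i = 1 → ∀ k : Fin 4, k = 2 ∨ k = 3 → g.Λ i k = 0 ∧ g.Λ k i = 0) ∧
      g.a 0 = 0 ∧ g.a 1 = 0 ∧ 0 < g.Λ 1 1 := by
  have closedWedge : ∀ {h : Poincare}, h.act '' stdWedge = stdWedge →
      (h.Λ 0 2 = 0 ∧ h.Λ 1 2 = 0 ∧ h.Λ 0 3 = 0 ∧ h.Λ 1 3 = 0) ∧ |h.a 0| ≤ h.a 1 ∧
        0 ≤ h.Λ 1 1 := by
    intro h hh
    have key : ∀ s b c : ℝ, 0 < s →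
        |h.Λ 0 1 * s + h.Λ 0 2 * b + h.Λ 0 3 * c + h.a 0|
          < h.Λ 1 1 * s + h.Λ 1 2 * b + h.Λ 1 3 * c + h.a 1 := by
      intro s b c hs
      have hm : h.act ![0, s, b, c] ∈ stdWedge := by
        rw [← hh]
        exact ⟨_, by simpa [stdWedge] using hs, rfl⟩
      simpa [stdWedge, act, Matrix.mulVec, dotProduct, Fin.sum_univ_four] using hm
    -- Wedge points have unrestricted `y`, `z` coordinates, and an affine function positive on a
    -- whole line is constant. On the ray `s > 0` only slope and limit at 0 must be nonnegative.
    have lin : ∀ {m n : ℝ}, (∀ b, 0 < m * b + n) → m = 0 := by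
      intro m n hmn
      by_contra hm
      have := hmn (-(n / m))
      field_simp at this
      simp at this
    have lin' : ∀ {m n : ℝ}, (∀ s, 0 < s → 0 < m * s + n) → 0 ≤ m ∧ 0 ≤ n := by
      intro m n hmn
      constructor
      · by_contra hm
        push Not at hm
        have h1 := hmn 1 one_pos
        have h2 := hmn (n / -m) (div_pos (by linarith) (by linarith))
        have e : m * (n / -m) = -n := by rw [div_neg, mul_neg, mul_div_cancel₀ _ hm.ne]
        linarith
      · by_contra hn
        push Not at hn
        have h1 := hmn 1 one_pos
        have hm : 0 < m := by linarith
        have h2 := hmn (-n / m) (div_pos (by linarith) hm)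
        have e : m * (-n / m) = -n := by field_simp
        linarith
    have h12 : h.Λ 1 2 = 0 := lin (n := h.Λ 1 1 + h.a 1) fun b => by
      have := (abs_nonneg _).trans_lt (key 1 b 0 one_pos)
      linarith
    have h13 : h.Λ 1 3 = 0 := lin (n := h.Λ 1 1 + h.a 1) fun b => by
      have := (abs_nonneg _).trans_lt (key 1 0 b one_pos)
      linarith
    have h02 : h.Λ 0 2 = 0 := lin (n := h.Λ 0 1 + h.a 0 + h.Λ 1 1 + h.a 1) fun b => by
      have := neg_lt_of_abs_lt (key 1 b 0 one_pos)
      rw [h12] at this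
      linarith
    have h03 : h.Λ 0 3 = 0 := lin (n := h.Λ 0 1 + h.a 0 + h.Λ 1 1 + h.a 1) fun b => by
      have := neg_lt_of_abs_lt (key 1 0 b one_pos)
      rw [h13] at this
      linarith
    have p := lin' (m := h.Λ 1 1 + h.Λ 0 1) (n := h.a 1 + h.a 0) fun s hs => by
      have := neg_lt_of_abs_lt (key s 0 0 hs)
      linarith
    have q := lin' (m := h.Λ 1 1 - h.Λ 0 1) (n := h.a 1 - h.a 0) fun s hs => by
      have := lt_of_abs_lt (key s 0 0 hs)
      linarith
    exact ⟨⟨h02, h12, h03, h13⟩, abs_le.2 ⟨by linarith [p.2], by linarith [q.2]⟩,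
      by linarith [p.1, q.1]⟩
  have hg' : g⁻¹.act '' stdWedge = stdWedge := by
    conv_lhs => rw [← hg]
    rw [← image_mul_act, inv_mul_cancel]
    simp [one_act]
  obtain ⟨⟨h02, h12, h03, h13⟩, ha, hd⟩ := closedWedge hg
  obtain ⟨-, ha', -⟩ := closedWedge hg'
  have row : ∀ i j, g.Λ i 0 * g.Λ j 0 - g.Λ i 1 * g.Λ j 1 - g.Λ i 2 * g.Λ j 2
      - g.Λ i 3 * g.Λ j 3 = eta i j := fun i j => by rw [← mdot_row g i j, mdot_eq]
  have r00 := row 0 0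
  have r01 := row 0 1
  have r11 := row 1 1
  simp only [h02, h12, h03, h13, eta, Matrix.diagonal_apply] at r00 r01 r11
  norm_num at r00 r01 r11
  have hd' : 0 < g.Λ 1 1 := by
    rcases hd.lt_or_eq with h | h
    · exact h
    · rw [← h] at r11
      nlinarith [sq_nonneg (g.Λ 1 0)]
  have hlow : ∀ k : Fin 4, k = 2 ∨ k = 3 → g.Λ k 0 = 0 ∧ g.Λ k 1 = 0 := by
    intro k hk
    have e0 := row k 0
    have e1 := row k 1
    simp only [h02, h12, h03, h13, eta, Matrix.diagonal_apply] at e0 e1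
    have hk0 : k ≠ 0 := by rcases hk with rfl | rfl <;> decide
    have hk1 : k ≠ 1 := by rcases hk with rfl | rfl <;> decide
    simp only [hk0, hk1, if_false] at e0 e1
    -- The `t-x` block is a two-dimensional Lorentz matrix, hence invertible. Rows 2 and 3 are
    -- orthogonal to rows 0 and 1, so their `t-x` entries vanish.
    have d2 : (g.Λ 0 0 * g.Λ 1 1 - g.Λ 0 1 * g.Λ 1 0) ^ 2 = 1 := by
      linear_combination (-g.Λ 0 0 * g.Λ 0 0 + g.Λ 0 1 * g.Λ 0 1) * r11 + r00
        + (g.Λ 0 0 * g.Λ 1 0 - g.Λ 0 1 * g.Λ 1 1) * r01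
    have dne : g.Λ 0 0 * g.Λ 1 1 - g.Λ 0 1 * g.Λ 1 0 ≠ 0 := fun h => by
      rw [h] at d2
      norm_num at d2
    constructor
    · refine (mul_eq_zero.1 (?_ : (g.Λ 0 0 * g.Λ 1 1 - g.Λ 0 1 * g.Λ 1 0) * g.Λ k 0
        = 0)).resolve_left dne
      linear_combination g.Λ 1 1 * e0 - g.Λ 0 1 * e1
    · refine (mul_eq_zero.1 (?_ : (g.Λ 0 0 * g.Λ 1 1 - g.Λ 0 1 * g.Λ 1 0) * g.Λ k 1
        = 0)).resolve_left dne
      linear_combination g.Λ 1 0 * e0 - g.Λ 0 0 * e1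
  have hsum : g.Λ 1 0 * g⁻¹.a 0 + g.Λ 1 1 * g⁻¹.a 1 + g.a 1 = 0 := by
    have : (g * g⁻¹).a 1 = 0 := by rw [mul_inv_cancel]; rfl
    simp only [mul_a, Pi.add_apply, Matrix.mulVec, dotProduct, Fin.sum_univ_four, h12, h13] at this
    linarith
  have hlt : |g.Λ 1 0| ≤ g.Λ 1 1 := abs_le_of_sq_le_sq (by nlinarith) hd'.le
  -- The translation parts of `g` and `g⁻¹` both lie over the closed wedge `x ≥ |t|`. The linear
  -- part of `g` keeps the latter there, and `hsum` makes the two `x` coordinates cancel.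
  have ha1 : g.a 1 = 0 := by
    have h1 : -(g.Λ 1 0 * g⁻¹.a 0) ≤ g.Λ 1 1 * g⁻¹.a 1 := by
      refine (neg_le_abs _).trans ?_
      rw [abs_mul]
      exact mul_le_mul hlt ha' (abs_nonneg _) hd'.le
    have h2 := (abs_nonneg _).trans ha
    linarith
  have ha0 : g.a 0 = 0 := by
    rw [ha1] at ha
    exact abs_nonpos_iff.1 ha
  refine ⟨?_, ha0, ha1, hd'⟩
  rintro i (rfl | rfl) k hk <;> refine ⟨?_, ?_⟩ <;>
    first
    | exact (hlow k hk).1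
    | exact (hlow k hk).2
    | rcases hk with rfl | rfl <;> assumption

/-- The matrix is block diagonal, `r` is `-1` on the `t-x` block and `1` on the other, and the
translation lies in the `y-z` plane. -/
theorem stabilizer_mul_reflection {g : Poincare} (hg : g.act '' stdWedge = stdWedge) :
    g * reflection = reflection * g := by
  obtain ⟨h, ha0, ha1, -⟩ := entries_of_stabilizer hg
  have e1 := h 0 (.inl rfl) 2 (.inl rfl)
  have e2 := h 0 (.inl rfl) 3 (.inr rfl)
  have e3 := h 1 (.inr rfl) 2 (.inl rfl)
  have e4 := h 1 (.inr rfl) 3 (.inr rfl)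
  ext1
  · rw [mul_Λ, mul_Λ, reflection]
    ext i j
    rw [Matrix.diagonal_mul, Matrix.mul_diagonal]
    fin_cases i <;> fin_cases j <;> simp [e1, e2, e3, e4]
  · ext i
    fin_cases i <;> simp [mul_a, reflection, Matrix.mulVec_diagonal, ha0, ha1]

/-- With `Λ 1 1 > 0` the `t-x` block is either a boost or a boost combined with time reversal. The
former commutes with boosts, the latter inverts the rapidity. -/
theorem stabilizer_mul_boost {g : Poincare} (hg : g.act '' stdWedge = stdWedge) :
    (0 < g.Λ 0 0 ∧ ∀ χ, g * boost χ = boost χ * g) ∨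
      (g.Λ 0 0 < 0 ∧ ∀ χ, g * boost χ = boost (-χ) * g) := by
  obtain ⟨h, ha0, ha1, hd⟩ := entries_of_stabilizer hg
  have e1 := h 0 (.inl rfl) 2 (.inl rfl)
  have e2 := h 0 (.inl rfl) 3 (.inr rfl)
  have e3 := h 1 (.inr rfl) 2 (.inl rfl)
  have e4 := h 1 (.inr rfl) 3 (.inr rfl)
  have row : ∀ i j, g.Λ i 0 * g.Λ j 0 - g.Λ i 1 * g.Λ j 1 - g.Λ i 2 * g.Λ j 2
      - g.Λ i 3 * g.Λ j 3 = eta i j := fun i j => by rw [← mdot_row g i j, mdot_eq]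
  have r00 := row 0 0
  have r01 := row 0 1
  have r11 := row 1 1
  simp only [e1, e2, e3, e4, eta, Matrix.diagonal_apply] at r00 r01 r11
  norm_num at r00 r01 r11
  have hsq : (g.Λ 0 0 - g.Λ 1 1) * (g.Λ 0 0 + g.Λ 1 1) = 0 := by
    linear_combination (g.Λ 1 1 * g.Λ 1 1) * r00 + (g.Λ 0 0 * g.Λ 0 0) * r11
      - (g.Λ 0 0 * g.Λ 1 0 + g.Λ 0 1 * g.Λ 1 1) * r01
  have act_a : ∀ χ, (boost χ * g).a = g.a := fun χ => by
    ext i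
    fin_cases i <;>
      simp [mul_a, boost, ha0, ha1, dotProduct, Fin.sum_univ_four]
  have a_act : ∀ χ, (g * boost χ).a = g.a := fun χ => by simp [mul_a, boost]
  rcases mul_eq_zero.1 hsq with h0 | h0
  · have hΛ : g.Λ 0 0 = g.Λ 1 1 := by linarith
    have hb : g.Λ 1 0 = g.Λ 0 1 := mul_left_cancel₀ hd.ne' (by rw [hΛ] at r01; linarith)
    refine .inl ⟨hΛ ▸ hd, fun χ => Poincare.ext ?_ ((a_act χ).trans (act_a χ).symm)⟩
    rw [mul_Λ, mul_Λ]
    ext i j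
    fin_cases i <;> fin_cases j <;>
      simp [boost, Matrix.mul_apply, Fin.sum_univ_four, e1, e2, e3, e4, hΛ, hb] <;> ring
  · have hΛ : g.Λ 0 0 = -g.Λ 1 1 := by linarith
    have hb : g.Λ 1 0 = -g.Λ 0 1 := mul_left_cancel₀ hd.ne' (by rw [hΛ] at r01; linarith)
    refine .inr ⟨by linarith, fun χ => Poincare.ext ?_ ((a_act χ).trans (act_a (-χ)).symm)⟩
    rw [mul_Λ, mul_Λ]
    ext i j
    fin_cases i <;> fin_cases j <;>
      simp [boost, Matrix.mul_apply, Fin.sum_univ_four, e1, e2, e3, e4, hΛ, hb] <;> ring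

theorem time_orientation (g : Poincare) : 0 < g.Λ 0 0 ∨ g.Λ 0 0 < 0 := by
  have h := mdot_row g 0 0
  rw [mdot_eq] at h
  simp only [eta, Matrix.diagonal_apply_eq, Matrix.cons_val_zero] at h
  refine (lt_or_gt_of_ne (Ne.symm fun h0 => ?_))
  rw [h0] at h
  nlinarith [sq_nonneg (g.Λ 0 1), sq_nonneg (g.Λ 0 2), sq_nonneg (g.Λ 0 3)]

end Poincare

/-! ### Wedges, double cones and causal complements -/

/-- The wedge opposite to `g W` is `g r W`. -/
theorem mem_image_mul_reflection {g : Poincare} {v : Mink} :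
    v ∈ (g * Poincare.reflection).act '' stdWedge ↔ |g⁻¹.act v 0| < -g⁻¹.act v 1 := by
  rw [Poincare.mem_image_act, mul_inv_rev, Poincare.mul_act,
    inv_eq_of_mul_eq_one_left Poincare.reflection_mul_reflection, Poincare.reflection_act]
  simp [stdWedge]

theorem msq_sub_neg_of_mem_opposite {x y : Mink} (hx : x ∈ stdWedge) (hy : |y 0| < -y 1) :
    msq (x - y) < 0 := by
  have hx : |x 0| < x 1 := hx
  rw [msq_eq]
  simp only [Pi.sub_apply]
  have : |x 0 - y 0| < x 1 - y 1 := (abs_sub _ _).trans_lt (by linarith)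
  have := sq_lt_sq' (neg_lt_of_abs_lt this) (lt_of_abs_lt this)
  nlinarith [sq_nonneg (x 2 - y 2), sq_nonneg (x 3 - y 3)]

theorem abs_le_of_spacelike_stdWedge {z : Mink} (hz : ∀ w ∈ stdWedge, msq (w - z) < 0) :
    |z 0| ≤ -z 1 := by
  by_contra! h
  -- This point differs from `z` by a lightlike or zero vector.
  have := hz ![0, z 1 + |z 0|, z 2, z 3] (by simp [stdWedge]; linarith)
  rw [msq_eq] at this
  simp at this

theorem isOpen_forwardCone : IsOpen forwardCone := by
  have h : forwardCone = {v : Mink | 0 < v 0} ∩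
      {v : Mink | 0 < v 0 ^ 2 - v 1 ^ 2 - v 2 ^ 2 - v 3 ^ 2} := by
    ext v
    simp [forwardCone, msq_eq]
  rw [h]
  exact (isOpen_lt continuous_const (by fun_prop)).inter
    (isOpen_lt continuous_const (by fun_prop))

theorem IsDoubleCone.isOpen {O : Set Mink} (hO : IsDoubleCone O) : IsOpen O := by
  obtain ⟨p, q, -, rfl⟩ := hO
  exact (isOpen_forwardCone.preimage (by fun_prop : Continuous fun v : Mink => v - p)).inter
    (isOpen_forwardCone.preimage (by fun_prop : Continuous fun v : Mink => q - v))

/-- The points spacelike to a whole wedge form at most the closed opposite wedge. Openness of `O`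
makes the inequality strict, by a small shift of `y` towards the wedge. -/
theorem wedge_subset_causalCompl_iff {O : Set Mink} (hO : IsOpen O) (g : Poincare) :
    g.act '' stdWedge ⊆ causalCompl O ↔ O ⊆ (g * Poincare.reflection).act '' stdWedge := by
  constructor
  · intro h
    have weak : ∀ y ∈ O, |g⁻¹.act y 0| ≤ -g⁻¹.act y 1 := fun y hy => by
      refine abs_le_of_spacelike_stdWedge fun w hw => ?_
      rw [← Poincare.msq_act_sub_act g, Poincare.act_inv_act]
      exact h ⟨w, hw, rfl⟩ y hy
    intro y hy
    rw [mem_image_mul_reflection]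
    let e : Mink := Pi.single 1 1
    have hcont : Continuous fun t : ℝ => y + t • (g.Λ *ᵥ e) := by fun_prop
    have hmem : ∀ᶠ t in nhds (0 : ℝ), y + t • (g.Λ *ᵥ e) ∈ O :=
      hcont.continuousAt.eventually_mem (by simpa using hO.mem_nhds hy)
    obtain ⟨ε, hε, hball⟩ := Metric.eventually_nhds_iff.1 hmem
    have hs := weak _ (hball (y := ε / 2) (by simp [abs_of_pos hε]; linarith))
    have hact : g⁻¹.act (y + (ε / 2) • (g.Λ *ᵥ e)) = g⁻¹.act y + (ε / 2) • e := by
      have : g⁻¹.Λ *ᵥ (g.Λ *ᵥ e) = e := by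
        rw [Matrix.mulVec_mulVec, Poincare.inv_Λ, lorentz_inv_mul g.lorentz, Matrix.one_mulVec]
      rw [Poincare.act, Poincare.act, Matrix.mulVec_add, Matrix.mulVec_smul, this]
      abel
    rw [hact] at hs
    simp [e] at hs
    linarith
  · rintro h _ ⟨x, hx, rfl⟩ y hy
    have := mem_image_mul_reflection.1 (h hy)
    rw [← Poincare.act_inv_act g y, Poincare.msq_act_sub_act]
    exact msq_sub_neg_of_mem_opposite hx this

/-! ### Lorentz frames and wedges bounded by null hyperplanes -/

theorem mdot_add_left (u v w : Mink) : mdot (u + v) w = mdot u w + mdot v w := by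
  simp only [mdot_eq, Pi.add_apply]; ring

theorem mdot_sub_left (u v w : Mink) : mdot (u - v) w = mdot u w - mdot v w := by
  simp only [mdot_eq, Pi.sub_apply]; ring

theorem mdot_smul_left (c : ℝ) (v w : Mink) : mdot (c • v) w = c * mdot v w := by
  simp only [mdot_eq, Pi.smul_apply, smul_eq_mul]; ring

theorem mdot_comm (v w : Mink) : mdot v w = mdot w v := by
  simp only [mdot_eq]; ring

theorem mdot_smul_right (c : ℝ) (v w : Mink) : mdot v (c • w) = c * mdot v w := by
  rw [mdot_comm, mdot_smul_left, mdot_comm]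

/-- Nonzero vectors orthogonal to a timelike vector are spacelike. -/
theorem msq_neg_of_mdot_eq_zero {u v : Mink} (hu : 0 < mdot u u) (huv : mdot u v = 0)
    (hv : v ≠ 0) : mdot v v < 0 := by
  rw [mdot_eq] at *
  have hcs : (u 1 * v 1 + u 2 * v 2 + u 3 * v 3) ^ 2
      ≤ (u 1 ^ 2 + u 2 ^ 2 + u 3 ^ 2) * (v 1 ^ 2 + v 2 ^ 2 + v 3 ^ 2) := by
    nlinarith [sq_nonneg (u 1 * v 2 - u 2 * v 1), sq_nonneg (u 1 * v 3 - u 3 * v 1),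
      sq_nonneg (u 2 * v 3 - u 3 * v 2)]
  have he : u 1 * v 1 + u 2 * v 2 + u 3 * v 3 = u 0 * v 0 := by linarith
  rw [he] at hcs
  set S := u 1 ^ 2 + u 2 ^ 2 + u 3 ^ 2
  set T := v 1 ^ 2 + v 2 ^ 2 + v 3 ^ 2 with hT
  have hu' : S < u 0 ^ 2 := by simp only [S]; linarith
  have hS : 0 ≤ S := by positivity
  have hT0 : 0 ≤ T := by positivity
  by_contra! hcon
  have hc : T ≤ v 0 ^ 2 := by simp only [T]; linarith
  have hTz : T = 0 := by
    have h1 : u 0 ^ 2 * T ≤ S * T :=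
      (mul_le_mul_of_nonneg_left hc (sq_nonneg _)).trans (by linarith [mul_pow (u 0) (v 0) 2])
    nlinarith
  have hv0 : v 0 = 0 := by
    rw [hTz, mul_zero, mul_pow] at hcs
    have : 0 < u 0 ^ 2 := by linarith
    have : v 0 ^ 2 ≤ 0 := by nlinarith [sq_nonneg (v 0)]
    nlinarith [sq_nonneg (v 0)]
  apply hv
  have h1 : v 1 = 0 := by nlinarith [sq_nonneg (v 1), sq_nonneg (v 2), sq_nonneg (v 3)]
  have h2 : v 2 = 0 := by nlinarith [sq_nonneg (v 1), sq_nonneg (v 2), sq_nonneg (v 3)]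
  have h3 : v 3 = 0 := by nlinarith [sq_nonneg (v 1), sq_nonneg (v 2), sq_nonneg (v 3)]
  ext i
  fin_cases i <;> simpa

/-- Three linear conditions on four coordinates have a nonzero solution; padding with a zero row
expresses this as a singular matrix. Orthogonality to `u₀` makes the solution spacelike, so it can
be normalized. -/
theorem exists_orthogonal (u₀ u₁ u₂ : Mink) (h : 0 < mdot u₀ u₀) :
    ∃ v, mdot u₀ v = 0 ∧ mdot u₁ v = 0 ∧ mdot u₂ v = 0 ∧ mdot v v = -1 := by
  obtain ⟨v, hv, hz⟩ := Matrix.exists_mulVec_eq_zero_iff.2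
    (show (Matrix.of ![u₀, u₁, u₂, 0] * eta).det = 0 by
      rw [Matrix.det_mul, Matrix.det_eq_zero_of_row_eq_zero 3 (by simp), zero_mul])
  rw [← Matrix.mulVec_mulVec] at hz
  have h0 : mdot u₀ v = 0 := congrFun hz 0
  have h1 : mdot u₁ v = 0 := congrFun hz 1
  have h2 : mdot u₂ v = 0 := congrFun hz 2
  have hneg := msq_neg_of_mdot_eq_zero h h0 hv
  have hs : Real.sqrt (-mdot v v) ^ 2 = -mdot v v := Real.sq_sqrt (by linarith)
  have hs0 : Real.sqrt (-mdot v v) ≠ 0 := (Real.sqrt_pos.2 (by linarith)).ne'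
  refine ⟨(Real.sqrt (-mdot v v))⁻¹ • v, ?_, ?_, ?_, ?_⟩
  · rw [mdot_smul_right, h0, mul_zero]
  · rw [mdot_smul_right, h1, mul_zero]
  · rw [mdot_smul_right, h2, mul_zero]
  · rw [mdot_smul_left, mdot_smul_right]
    field_simp
    linarith

/-- Two orthonormal vectors, the first timelike, are the first two columns of a proper Lorentz
matrix. -/
theorem exists_poincare_of_frame {u₀ u₁ : Mink} (h00 : mdot u₀ u₀ = 1) (h11 : mdot u₁ u₁ = -1)
    (h01 : mdot u₀ u₁ = 0) (e : Mink) :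
    ∃ g : Poincare, g.a = e ∧ g.Λ *ᵥ Pi.single 0 1 = u₀ ∧ g.Λ *ᵥ Pi.single 1 1 = u₁ := by
  have hpos : 0 < mdot u₀ u₀ := by rw [h00]; exact one_pos
  obtain ⟨u₂, h02, h12, -, h22⟩ := exists_orthogonal u₀ u₁ 0 hpos
  obtain ⟨u₃, h03, h13, h23, h33⟩ := exists_orthogonal u₀ u₁ u₂ hpos
  have lor : ∀ s : ℝ, s ^ 2 = 1 → (Matrix.of ![u₀, u₁, u₂, s • u₃]) * eta *
      (Matrix.of ![u₀, u₁, u₂, s • u₃])ᵀ = eta := by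
    intro s hs
    have hss : s * s = 1 := by rw [← hs]; ring
    ext i j
    rw [mul_eta_mul_transpose_apply]
    change mdot (![u₀, u₁, u₂, s • u₃] i) (![u₀, u₁, u₂, s • u₃] j) = _
    fin_cases i <;> fin_cases j <;>
      simp [eta, mdot_smul_left, mdot_smul_right, mdot_comm u₁ u₀, mdot_comm u₂ u₀,
        mdot_comm u₃ u₀, mdot_comm u₂ u₁, mdot_comm u₃ u₁, mdot_comm u₃ u₂, *]
  set s := (Matrix.of ![u₀, u₁, u₂, u₃]).det with hs
  -- The determinant of the frame is `±1`; rescaling `u₃` by this sign makes the matrix proper.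
  have hs2 : s ^ 2 = 1 := by
    have h := congrArg Matrix.det (lor 1 (one_pow 2))
    have he : eta.det ≠ 0 := fun h0 => by
      have := congrArg Matrix.det eta_mul_eta
      simp [h0] at this
    rw [one_smul, Matrix.det_mul, Matrix.det_mul, Matrix.det_transpose, ← hs] at h
    exact mul_right_cancel₀ he (by linarith)
  have hdet : (Matrix.of ![u₀, u₁, u₂, s • u₃]).det = 1 := by
    have h : Matrix.of ![u₀, u₁, u₂, s • u₃]
        = (Matrix.of ![u₀, u₁, u₂, u₃]).updateRow 3 (s • u₃) := by
      ext i j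
      fin_cases i <;> simp [Matrix.updateRow_apply]
    have h' : (Matrix.of ![u₀, u₁, u₂, u₃]).updateRow 3 u₃ = Matrix.of ![u₀, u₁, u₂, u₃] := by
      ext i j
      fin_cases i <;> simp [Matrix.updateRow_apply]
    rw [h, Matrix.det_updateRow_smul, h', ← hs, ← sq, hs2]
  refine ⟨⟨(Matrix.of ![u₀, u₁, u₂, s • u₃])ᵀ, e, ?_, ?_⟩, rfl, ?_, ?_⟩
  · rw [Matrix.transpose_transpose]
    exact lor s hs2
  · rw [Matrix.det_transpose, hdet]
  · ext i
    simp
  · ext i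
    simp

/-- The region cut out by two null hyperplanes through `e` and the opposite region are opposite
wedges. -/
theorem exists_poincare_of_null {k l : Mink} (hk : mdot k k = 0) (hl : mdot l l = 0)
    (hkl : 0 < mdot k l) (e : Mink) :
    ∃ g : Poincare, (g.act '' stdWedge = {v | mdot k (v - e) < 0 ∧ 0 < mdot l (v - e)}) ∧
      ((g * Poincare.reflection).act '' stdWedge
        = {v | 0 < mdot k (v - e) ∧ mdot l (v - e) < 0}) := by
  set c := mdot k l with hc
  have hlk : mdot l k = c := mdot_comm l k
  have hdot : ∀ a b a' b' : ℝ, mdot (a • k + b • l) (a' • k + b' • l)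
      = (a * b' + b * a') * c := fun a b a' b' => by
    rw [mdot_add_left, mdot_smul_left, mdot_smul_left, mdot_comm k, mdot_comm l, mdot_add_left,
      mdot_add_left, mdot_smul_left, mdot_smul_left, mdot_smul_left, mdot_smul_left, hk, hl,
      hlk, ← hc]
    ring
  obtain ⟨g, rfl, h0, h1⟩ := exists_poincare_of_frame
    -- The coefficients give `k = u₀ + u₁` and `l = (c/2) (u₀ - u₁)`, so in wedge coordinates the
    -- forms `k` and `l` are `t - x` and a positive multiple of `t + x`.
    (u₀ := (1 / 2 : ℝ) • k + c⁻¹ • l) (u₁ := (1 / 2 : ℝ) • k + (-c⁻¹) • l)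
    (by rw [hdot]; field_simp; norm_num) (by rw [hdot]; field_simp; norm_num)
    (by rw [hdot]; field_simp; norm_num) e
  have hv : ∀ v, v - g.a = g.Λ *ᵥ (g⁻¹.act v) := fun v => by
    conv_lhs => rw [← Poincare.act_inv_act g v]
    simp [Poincare.act]
  have hkΛ : k = g.Λ *ᵥ (Pi.single 0 1 + Pi.single 1 1) := by
    rw [Matrix.mulVec_add, h0, h1]
    module
  have hlΛ : l = (c / 2) • (g.Λ *ᵥ (Pi.single 0 1 - Pi.single 1 1)) := by
    rw [Matrix.mulVec_sub, h0, h1, neg_smul]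
    rw [show ((1 / 2 : ℝ) • k + c⁻¹ • l - ((1 / 2 : ℝ) • k + -(c⁻¹ • l))) = (2 * c⁻¹) • l by
      module, smul_smul]
    field_simp
    simp
  have ek : ∀ v, mdot k (v - g.a) = g⁻¹.act v 0 - g⁻¹.act v 1 := fun v => by
    rw [hv, hkΛ, mdot_mulVec, mdot_eq]
    simp
  have el : ∀ v, mdot l (v - g.a) = c / 2 * (g⁻¹.act v 0 + g⁻¹.act v 1) := fun v => by
    rw [hv, hlΛ, mdot_smul_left, mdot_mulVec, mdot_eq]
    simp
  have hc2 : 0 < c / 2 := half_pos hkl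
  refine ⟨g, ?_, ?_⟩
  · ext v
    rw [Poincare.mem_image_act, Set.mem_ofPred_eq, ek, el, mul_pos_iff_of_pos_left hc2]
    change |g⁻¹.act v 0| < g⁻¹.act v 1 ↔ _
    rw [abs_lt]
    constructor <;> rintro ⟨h, h'⟩ <;> constructor <;> linarith
  · ext v
    rw [mem_image_mul_reflection, Set.mem_ofPred_eq, ek, el, ← neg_pos (a := c / 2 * _),
      ← mul_neg, mul_pos_iff_of_pos_left hc2, abs_lt]
    constructor <;> rintro ⟨h, h'⟩ <;> constructor <;> linarith

/-! ### Separation of double cones by a wedge -/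

theorem exists_null_mdot_nonpos {d : Mink} (hd : d ∉ forwardCone) :
    ∃ k : Mink, k 0 = 1 ∧ mdot k k = 0 ∧ mdot k d ≤ 0 := by
  set ρ := Real.sqrt (d 1 ^ 2 + d 2 ^ 2 + d 3 ^ 2) with hρ
  have hsq : ρ ^ 2 = d 1 ^ 2 + d 2 ^ 2 + d 3 ^ 2 := Real.sq_sqrt (by positivity)
  have hρ0 : 0 ≤ ρ := Real.sqrt_nonneg _
  have hle : d 0 ≤ ρ := by
    by_contra! h
    exact hd ⟨hρ0.trans_lt h, by rw [msq_eq]; nlinarith⟩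
  rcases hρ0.eq_or_lt with h | h
  · refine ⟨![1, 1, 0, 0], by simp, by simp [mdot_eq], ?_⟩
    have h1 : d 1 = 0 := by
      rw [← h] at hsq
      nlinarith [sq_nonneg (d 1), sq_nonneg (d 2), sq_nonneg (d 3)]
    simp [mdot_eq, h1]
    linarith
  · refine ⟨![1, d 1 / ρ, d 2 / ρ, d 3 / ρ], by simp, ?_, ?_⟩
    · simp [mdot_eq]
      field_simp
      linarith
    · simp [mdot_eq]
      have : d 1 / ρ * d 1 + d 2 / ρ * d 2 + d 3 / ρ * d 3 = ρ := by
        field_simp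
        linarith
      linarith

theorem mdot_pos_of_mem_forwardCone {k v : Mink} (hk0 : k 0 = 1) (hk : mdot k k = 0)
    (hv : v ∈ forwardCone) : 0 < mdot k v := by
  obtain ⟨hv0, hv⟩ := hv
  rw [msq_eq] at hv
  rw [mdot_eq, hk0] at *
  have hcs : (k 1 * v 1 + k 2 * v 2 + k 3 * v 3) ^ 2
      ≤ (k 1 ^ 2 + k 2 ^ 2 + k 3 ^ 2) * (v 1 ^ 2 + v 2 ^ 2 + v 3 ^ 2) := by
    nlinarith [sq_nonneg (k 1 * v 2 - k 2 * v 1), sq_nonneg (k 1 * v 3 - k 3 * v 1),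
      sq_nonneg (k 2 * v 3 - k 3 * v 2)]
  rw [show k 1 ^ 2 + k 2 ^ 2 + k 3 ^ 2 = 1 by linarith] at hcs
  have := abs_lt_of_sq_lt_sq (by linarith : (k 1 * v 1 + k 2 * v 2 + k 3 * v 3) ^ 2 < v 0 ^ 2)
    hv0.le
  linarith [lt_of_abs_lt this]

/-- For null vectors with time component 1, twice the product is the squared Euclidean distance of
the spatial parts. -/
theorem mdot_pos_of_ne {k l : Mink} (hk0 : k 0 = 1) (hk : mdot k k = 0) (hl0 : l 0 = 1)
    (hl : mdot l l = 0) (h : k ≠ l) : 0 < mdot k l := by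
  by_contra! hkl
  apply h
  rw [mdot_eq, hk0] at hk
  rw [mdot_eq, hl0] at hl
  rw [mdot_eq, hk0, hl0] at hkl
  have hs : (k 1 - l 1) ^ 2 + (k 2 - l 2) ^ 2 + (k 3 - l 3) ^ 2 ≤ 0 := by linarith
  have h1 : k 1 - l 1 = 0 := pow_eq_zero_iff two_ne_zero |>.1 <| le_antisymm
    (by linarith [sq_nonneg (k 2 - l 2), sq_nonneg (k 3 - l 3)]) (sq_nonneg _)
  have h2 : k 2 - l 2 = 0 := pow_eq_zero_iff two_ne_zero |>.1 <| le_antisymm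
    (by linarith [sq_nonneg (k 1 - l 1), sq_nonneg (k 3 - l 3)]) (sq_nonneg _)
  have h3 : k 3 - l 3 = 0 := pow_eq_zero_iff two_ne_zero |>.1 <| le_antisymm
    (by linarith [sq_nonneg (k 1 - l 1), sq_nonneg (k 2 - l 2)]) (sq_nonneg _)
  ext i
  fin_cases i
  · exact hk0.trans hl0.symm
  · exact sub_eq_zero.1 h1
  · exact sub_eq_zero.1 h2
  · exact sub_eq_zero.1 h3

theorem smul_mem_forwardCone {c : ℝ} (hc : 0 < c) {v : Mink} (hv : v ∈ forwardCone) :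
    c • v ∈ forwardCone := by
  refine ⟨mul_pos hc hv.1, ?_⟩
  have : msq (c • v) = c ^ 2 * msq v := by
    simp only [msq_eq, Pi.smul_apply, smul_eq_mul]
    ring
  rw [this]
  exact mul_pos (pow_pos hc 2) hv.2

/-- If all points of two double cones are spacelike to each other, then the upper tip of the first
is not in the future of the lower tip of the second. -/
theorem sub_notMem_forwardCone_of_spacelike {p₁ q₁ p₂ q₂ : Mink} (h₁ : q₁ - p₁ ∈ forwardCone)
    (h₂ : q₂ - p₂ ∈ forwardCone)
    (h : ∀ v, v - p₁ ∈ forwardCone → q₁ - v ∈ forwardCone →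
      ∀ w, w - p₂ ∈ forwardCone → q₂ - w ∈ forwardCone → msq (v - w) < 0) :
    q₁ - p₂ ∉ forwardCone := by
  intro hmem
  have hcont : Continuous fun t : ℝ => (q₁ - p₂) - t • ((q₁ - p₁) + (q₂ - p₂)) := by fun_prop
  have hev : ∀ᶠ t in nhds (0 : ℝ), (q₁ - p₂) - t • ((q₁ - p₁) + (q₂ - p₂)) ∈ forwardCone :=
    hcont.continuousAt.eventually_mem (by simpa using isOpen_forwardCone.mem_nhds hmem)
  obtain ⟨ε, hε, hball⟩ := Metric.eventually_nhds_iff.1 hev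
  obtain ⟨t, ht0, ht⟩ := exists_between (lt_min hε one_pos)
  have ht1 : 0 < 1 - t := by linarith [ht.trans_le (min_le_right _ _)]
  have hpos := (hball (y := t) (by
    rw [Real.dist_eq, sub_zero, abs_of_pos ht0]
    exact ht.trans_le (min_le_left _ _))).2
  -- Points slightly below the tip `q₁` and slightly above the tip `p₂` lie in the two double cones,
  -- yet their difference stays in the open forward cone.
  have hneg := h (q₁ - t • (q₁ - p₁))
    (by convert smul_mem_forwardCone ht1 h₁ using 1; module)
    (by convert smul_mem_forwardCone ht0 h₁ using 1; module)
    (p₂ + t • (q₂ - p₂))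
    (by convert smul_mem_forwardCone ht0 h₂ using 1; module)
    (by convert smul_mem_forwardCone ht1 h₂ using 1; module)
  rw [show q₁ - t • (q₁ - p₁) - (p₂ + t • (q₂ - p₂))
    = (q₁ - p₂) - t • ((q₁ - p₁) + (q₂ - p₂)) by module] at hneg
  exact hpos.not_gt hneg

/-- Spacelike separated double cones are separated by a wedge. -/
theorem exists_wedge_between {O₁ O₂ : Set Mink} (hO₁ : IsDoubleCone O₁) (hO₂ : IsDoubleCone O₂)
    (h : O₁ ⊆ causalCompl O₂) : ∃ W, IsWedge W ∧ O₁ ⊆ W ∧ W ⊆ causalCompl O₂ := by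
  have hopen := hO₂.isOpen
  obtain ⟨p₁, q₁, h₁, rfl⟩ := hO₁
  obtain ⟨p₂, q₂, h₂, rfl⟩ := hO₂
  have msq_comm : ∀ v w : Mink, msq (v - w) = msq (w - v) := fun v w => by
    simp only [msq_eq, Pi.sub_apply]
    ring
  obtain ⟨k, hk0, hk, hkd⟩ := exists_null_mdot_nonpos
    (sub_notMem_forwardCone_of_spacelike h₁ h₂ fun v hv hv' w hw hw' => h ⟨hv, hv'⟩ w ⟨hw, hw'⟩)
  obtain ⟨l, hl0, hl, hld⟩ := exists_null_mdot_nonpos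
    (sub_notMem_forwardCone_of_spacelike h₂ h₁ fun v hv hv' w hw hw' =>
      msq_comm v w ▸ h ⟨hw, hw'⟩ v ⟨hv, hv'⟩)
  have mdot_sub : ∀ u v w : Mink, mdot u (v - w) = mdot u v - mdot u w := fun u v w => by
    rw [mdot_comm, mdot_sub_left, mdot_comm v, mdot_comm w]
  have hne : k ≠ l := by
    -- If `k = l`, then `k·q₁ ≤ k·p₂ < k·q₂ ≤ k·p₁ < k·q₁`.
    rintro rfl
    have e1 := mdot_pos_of_mem_forwardCone hk0 hk h₁
    have e2 := mdot_pos_of_mem_forwardCone hk0 hk h₂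
    rw [mdot_sub] at *
    linarith
  have hkl := mdot_pos_of_ne hk0 hk hl0 hl hne
  -- The edge point satisfies `k·e = k·q₁` and `l·e = l·p₁`, so the bounding null hyperplanes pass
  -- through the tips `q₁` and `p₁` of the first double cone.
  set e : Mink := (mdot l p₁ / mdot k l) • k + (mdot k q₁ / mdot k l) • l with he
  have hke : mdot k e = mdot k q₁ := by
    rw [he, mdot_comm, mdot_add_left, mdot_smul_left, mdot_smul_left, hk, mdot_comm l k]
    field_simp
    ring
  have hle : mdot l e = mdot l p₁ := by
    rw [he, mdot_comm, mdot_add_left, mdot_smul_left, mdot_smul_left, hl]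
    field_simp
    ring
  obtain ⟨g, hg, hg'⟩ := exists_poincare_of_null hk hl hkl e
  rw [mdot_sub] at hkd hld
  refine ⟨g.act '' stdWedge, ⟨g, rfl⟩, ?_, ?_⟩
  · rintro v ⟨hv, hv'⟩
    have e1 := mdot_pos_of_mem_forwardCone hk0 hk hv'
    have e2 := mdot_pos_of_mem_forwardCone hl0 hl hv
    rw [mdot_sub] at e1 e2
    rw [hg, Set.mem_ofPred_eq, mdot_sub, mdot_sub, hke, hle]
    constructor <;> linarith
  · rw [wedge_subset_causalCompl_iff hopen, hg']
    rintro v ⟨hv, hv'⟩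
    have e1 := mdot_pos_of_mem_forwardCone hk0 hk hv
    have e2 := mdot_pos_of_mem_forwardCone hl0 hl hv'
    rw [mdot_sub] at e1 e2
    rw [Set.mem_ofPred_eq, mdot_sub, mdot_sub, hke, hle]
    constructor <;> linarith

/-! ### Modular localization -/

namespace WignerRep

variable {H : Type*} [NormedAddCommGroup H] [InnerProductSpace ℂ H] (R : WignerRep H)

theorem j_smul (c : ℂ) (ψ : H) : R.j (c • ψ) = conj c • R.j ψ :=
  R.antiunitary _ (by simp [Poincare.reflection]) c ψ

theorem U_mul_apply (g h : Poincare) (ψ : H) : R.U (g * h) ψ = R.U g (R.U h ψ) := by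
  rw [map_mul]
  rfl

theorem j_j (ψ : H) : R.j (R.j ψ) = ψ := by
  rw [j, ← U_mul_apply, Poincare.reflection_mul_reflection, map_one]
  rfl

theorem j_modGroup (t : ℝ) (ψ : H) : R.j (R.modGroup t ψ) = R.modGroup t (R.j ψ) := by
  rw [j, modGroup, ← U_mul_apply, ← U_mul_apply, Poincare.reflection_mul_boost]

theorem isUnitaryGroup_modGroup : IsUnitaryGroup R.modGroup where
  add s t ψ := by
    rw [modGroup, modGroup, modGroup, ← U_mul_apply, ← Poincare.boost_add, mul_add]
  smul t c ψ := R.unitary _ (by simp [Poincare.boost, Real.cosh_pos]) c ψ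
  cont := R.continuous_modGroup

/-- As `j` is an involution, `s ψ = -ψ` forces the value of `δ^{1/2} ψ`, which removes the
existential quantifier. -/
theorem mem_stdSpace {ψ : H} :
    ψ ∈ R.stdSpace ↔ IsExp (fun t => R.modGroup t) (1 / 2) ψ (-R.j ψ) := by
  constructor
  · rintro ⟨φ, h, e⟩
    have : φ = -R.j ψ := by rw [← R.j_j φ, e, map_neg]
    rwa [← this]
  · exact fun h => ⟨_, h, by rw [map_neg, j_j]⟩

theorem isClosed_stdSpace : IsClosed (R.stdSpace : Set H) := by
  have h : (R.stdSpace : Set H) = (fun ψ => (ψ, -R.j ψ)) ⁻¹'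
      {p : H × H | IsExp (fun t => R.modGroup t) (1 / 2) p.1 p.2} := by
    ext ψ
    exact R.mem_stdSpace
  rw [h]
  exact (isClosed_isExp R.isUnitaryGroup_modGroup _).preimage
    (continuous_id.prodMk R.j.continuous.neg)

theorem isClosed_transport (g : Poincare) : IsClosed (R.transport g R.stdSpace : Set H) :=
  (R.U g).toHomeomorph.isClosedMap _ R.isClosed_stdSpace

theorem transport_mul (g h : Poincare) (K : Submodule ℝ H) :
    R.transport (g * h) K = R.transport g (R.transport h K) := by
  ext φ
  constructor
  · rintro ⟨ψ, hψ, rfl⟩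
    exact ⟨R.U h ψ, ⟨ψ, hψ, rfl⟩, (R.U_mul_apply g h ψ).symm⟩
  · rintro ⟨_, ⟨ψ, hψ, rfl⟩, rfl⟩
    exact ⟨ψ, hψ, R.U_mul_apply g h ψ⟩

/-- `U(g)` commutes with `j` and with `δ^{1/2}`: if `g` reverses time, antilinearity compensates the
inversion of the boosts. -/
theorem transport_le_of_stabilizer {g : Poincare} (hg : g.act '' stdWedge = stdWedge) :
    R.transport g R.stdSpace ≤ R.stdSpace := by
  rintro _ ⟨ψ, hψ, rfl⟩
  change R.U g ψ ∈ R.stdSpace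
  have hψ := R.mem_stdSpace.1 hψ
  rw [mem_stdSpace]
  have hj : -R.j (R.U g ψ) = R.U g (-R.j ψ) := by
    rw [map_neg, j, ← U_mul_apply, ← U_mul_apply, Poincare.stabilizer_mul_reflection hg]
  rw [hj]
  rcases Poincare.stabilizer_mul_boost hg with ⟨h0, hb⟩ | ⟨h0, hb⟩
  · refine hψ.map_of_linear (R.unitary g h0) fun t φ => ?_
    rw [modGroup, ← U_mul_apply, ← U_mul_apply, hb]
  · refine hψ.map_of_antilinear_of_neg (R.antiunitary g h0) fun t φ => ?_
    rw [modGroup, modGroup, ← U_mul_apply, ← U_mul_apply, hb, mul_neg]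

/-- The space `U(g) H_R` depends on the wedge `g W` only. -/
theorem transport_le_of_image_eq {g h : Poincare}
    (hgh : g.act '' stdWedge = h.act '' stdWedge) :
    R.transport g R.stdSpace ≤ R.transport h R.stdSpace := by
  have hs : (h⁻¹ * g).act '' stdWedge = stdWedge := by
    rw [Poincare.image_mul_act, hgh, ← Poincare.image_mul_act, inv_mul_cancel]
    simp [Poincare.one_act]
  have : R.transport g R.stdSpace = R.transport h (R.transport (h⁻¹ * g) R.stdSpace) := by
    rw [← transport_mul, mul_inv_cancel_left]
  rw [this]
  exact Submodule.map_mono (R.transport_le_of_stabilizer hs)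

theorem wedgeSpace_image (g : Poincare) :
    R.wedgeSpace (g.act '' stdWedge) = R.transport g R.stdSpace := by
  apply le_antisymm
  · exact iInf_le_of_le g (iInf_le _ rfl)
  · exact le_iInf fun h => le_iInf fun hh => R.transport_le_of_image_eq hh

theorem isClosed_wedgeSpace {W : Set Mink} (hW : IsWedge W) :
    IsClosed (R.wedgeSpace W : Set H) := by
  obtain ⟨g, rfl⟩ := hW
  rw [wedgeSpace_image]
  exact R.isClosed_transport g

theorem isClosed_space (O : Set Mink) : IsClosed (R.space O : Set H) := by
  simp only [space, Submodule.coe_iInf]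
  exact isClosed_iInter fun W => isClosed_iInter fun hW => isClosed_iInter fun _ =>
    R.isClosed_wedgeSpace hW

variable [CompleteSpace H]

theorem symplCompl_stdSpace :
    symplCompl R.stdSpace = R.transport Poincare.reflection R.stdSpace := by
  ext φ
  have h := im_inner_eq_zero_iff_isExp R.isUnitaryGroup_modGroup R.j_smul R.j_j R.j_modGroup
    (1 / 2) φ
  simp only [← R.mem_stdSpace] at h
  rw [mem_symplCompl, h]
  conv_lhs => rw [← R.j_j φ, j_j, ← mem_stdSpace]
  constructor
  · exact fun hφ => ⟨R.j φ, hφ, R.j_j φ⟩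
  · rintro ⟨ψ, hψ, rfl⟩
    change R.j (R.j ψ) ∈ _
    rwa [j_j]

/-- Wedge duality. -/
theorem symplCompl_wedgeSpace (g : Poincare) :
    symplCompl (R.wedgeSpace (g.act '' stdWedge))
      = R.wedgeSpace ((g * Poincare.reflection).act '' stdWedge) := by
  rw [wedgeSpace_image, wedgeSpace_image, transport_mul, ← symplCompl_stdSpace]
  refine symplCompl_map (fun ψ φ => ?_) _
  rcases g.time_orientation with h | h
  · rw [inner_map_map_of_linear (R.unitary g h)]
  · rw [inner_map_map_of_antilinear (R.antiunitary g h), Complex.conj_im, neg_eq_zero]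

/-- The complement of the closed span is the intersection of the complements. By wedge duality these
belong to the opposite wedges, which are exactly the wedges containing `O`. -/
theorem symplCompl_complSpace {O : Set Mink} (hO : IsOpen O) :
    symplCompl (R.complSpace (causalCompl O)) = R.space O := by
  simp only [complSpace, symplCompl_topologicalClosure, symplCompl_iSup]
  apply le_antisymm
  · refine le_iInf fun W => le_iInf₂ ?_
    rintro ⟨g, rfl⟩ hOW
    have hg : g = g * Poincare.reflection * Poincare.reflection := by
      rw [mul_assoc, Poincare.reflection_mul_reflection, mul_one]
    rw [hg] at hOW ⊢
    rw [← symplCompl_wedgeSpace]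
    exact iInf_le_of_le _ (iInf₂_le ⟨_, rfl⟩ ((wedge_subset_causalCompl_iff hO _).2 hOW))
  · refine le_iInf fun W => le_iInf₂ ?_
    rintro ⟨g, rfl⟩ hW
    rw [symplCompl_wedgeSpace]
    exact iInf_le_of_le _ (iInf₂_le ⟨_, rfl⟩ ((wedge_subset_causalCompl_iff hO _).1 hW))

end WignerRep

end ModLoc

theorem theorem2 {H : Type*} [NormedAddCommGroup H] [InnerProductSpace ℂ H] [CompleteSpace H]
    (R : ModLoc.WignerRep H) :
    -- the wedge spaces `H_R(gW) = U(g) H_R` are well defined and closed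
    (∀ g : ModLoc.Poincare,
      R.wedgeSpace (g.act '' ModLoc.stdWedge) = R.transport g R.stdSpace ∧
      IsClosed (R.wedgeSpace (g.act '' ModLoc.stdWedge) : Set H)) ∧
    -- closed real subspaces
    (∀ O, ModLoc.IsDoubleCone O →
      IsClosed (R.space O : Set H) ∧
      IsClosed (R.complSpace (ModLoc.causalCompl O) : Set H)) ∧
    -- net property (isotony) for double cones and their causal complements
    (∀ O₁ O₂, ModLoc.IsDoubleCone O₁ → ModLoc.IsDoubleCone O₂ →
      (O₁ ⊆ O₂ → R.space O₁ ≤ R.space O₂) ∧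
      (ModLoc.causalCompl O₁ ⊆ ModLoc.causalCompl O₂ →
        R.complSpace (ModLoc.causalCompl O₁) ≤ R.complSpace (ModLoc.causalCompl O₂)) ∧
      (O₁ ⊆ ModLoc.causalCompl O₂ →
        R.space O₁ ≤ R.complSpace (ModLoc.causalCompl O₂))) ∧
    -- duality
    (∀ O, ModLoc.IsDoubleCone O →
      R.complSpace (ModLoc.causalCompl O) = ModLoc.symplCompl (R.space O) ∧
      ModLoc.symplCompl (R.space O) = ModLoc.iMul (ModLoc.realOrtho (R.space O)) ∧
      R.space O = ModLoc.symplCompl (R.complSpace (ModLoc.causalCompl O))) := by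
  refine ⟨fun g => ⟨R.wedgeSpace_image g, R.isClosed_wedgeSpace ⟨g, rfl⟩⟩,
    fun O _ => ⟨R.isClosed_space O, Submodule.isClosed_topologicalClosure _⟩,
    fun O₁ O₂ hO₁ hO₂ => ⟨fun h => ?_, fun h => ?_, fun h => ?_⟩, fun O hO => ⟨?_, ?_, ?_⟩⟩
  · exact le_iInf fun W => le_iInf₂ fun hW hOW => iInf_le_of_le W (iInf₂_le hW (h.trans hOW))
  · exact Submodule.topologicalClosure_mono
      (iSup_le fun W => iSup₂_le fun hW hWO => le_iSup_of_le W (le_iSup₂_of_le hW (hWO.trans h)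
        le_rfl))
  -- A wedge between the regions occurs in the intersection for `O₁` and in the span for `O₂'`.
  · obtain ⟨W, hW, h₁, h₂⟩ := ModLoc.exists_wedge_between hO₁ hO₂ h
    refine (iInf_le_of_le W (iInf₂_le hW h₁) : R.space O₁ ≤ R.wedgeSpace W).trans ?_
    refine le_trans ?_ (Submodule.le_topologicalClosure _)
    exact le_iSup_of_le W (le_iSup_of_le hW (le_iSup_of_le h₂ le_rfl))
  -- Replacing `H_R(O)` by `H_R(O')'` leaves the bicommutant identity for the closed space
  -- `H_R(O')`.
  · rw [← R.symplCompl_complSpace hO.isOpen]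
    exact (ModLoc.symplCompl_symplCompl (Submodule.isClosed_topologicalClosure _)).symm
  · exact ModLoc.symplCompl_eq_iMul_realOrtho _
  · exact (R.symplCompl_complSpace hO.isOpen).symm
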